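/- Let $n\ge 1$, let $\Omega\subset\mathbb{C}^n$ be a domain and let $\varphi\colon\Omega\to\mathbb{R}$ be continuous. For $r,s>0$ and a unitary matrix $A\in\mathbf{U}(n)$ put $P_{r,s,A}=A(\Delta_r\times\mathbb{B}^{n-1}_s)$, where $\Delta_r=\{z\in\mathbb{C}: |z|<r\}$ and $\mathbb{B}^{n-1}_s=\{z\in\mathbb{C}^{n-1}: |z|<s\}$, and let $|P_{r,s,A}|$ be its Lebesgue measure. Let $\Omega_{\widetilde\delta}$ be the set of all $(a,r,s,A)\in\Omega\times\mathbb{R}_{>0}\times\mathbb{R}_{>0}\times\mathbf{U}(n)$ with $a+P_{r,s,A}\subset\Omega$. For $(a,r,s,A)\in\Omega_{\widetilde\delta}$ define the $L^2$-extension index $$L_\varphi(a,r,s,A)=\inf_f \frac{\int_{a+P_{r,s,A}}|f|^2e^{-\varphi}}{|P_{r,s,A}|e^{-\varphi(a)}}\in[0,\infty],$$ where $f$ runs over the holomorphic functions on $a+P_{r,s,A}$ with $f(a)=1$ and $\int_{a+P_{r,s,A}}|f|^2e^{-\varphi}<\infty$ (and $\inf\emptyset=\infty$). A function is pluriharmonic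 on $\Omega$ if it is $C^2$ and its restriction to every complex line is harmonic where it is defined. Then: 1. $\varphi$ is pluriharmonic on $\Omega$ if and only if for every $(a,r,s,A)\in\Omega_{\widetilde\delta}$ there exists a unique holomorphic function $f$ on $a+P_{r,s,A}$ satisfying $f(a)=1$ and $$\int_{a+P_{r,s,A}}|f|^2e^{-\varphi}\le |P_{r,s,A}|\,e^{-\varphi(a)}.\qquad(*)$$ 2. If $\varphi$ is pluriharmonic on $\Omega$, then for every $(a,r,s,A)\in\Omega_{\widetilde\delta}$, every holomorphic $f$ on $a+P_{r,s,A}$ with $f(a)=1$ and $(*)$ satisfies equality in $(*)$. 3. $\varphi$ is pluriharmonic on $\Omega$ if and only if $L_\varphi(a,r,s,A)=1$ for all $(a,r,s,A)\in\Omega_{\widetilde\delta}$. -/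

import Mathlib

open MeasureTheory
open scoped ENNReal

noncomputable section

/-- The space `ℂⁿ` for `n = m + 1`, with its Euclidean norm and Lebesgue measure. -/
abbrev CSpace (m : ℕ) : Type := EuclideanSpace ℂ (Fin (m + 1))

/-- The holomorphic cylinder `P_{r,s,A} = A(Δ_r × 𝔹ᵐ_s)` centred at the origin, where `Δ_r` is the
open disc of radius `r` in `ℂ`, `𝔹ᵐ_s` is the open Euclidean ball of radius `s` in `ℂᵐ`, and `A` is
a unitary matrix of size `m + 1`. -/
def holoCylinder {m : ℕ} (r s : ℝ) (A : Matrix.unitaryGroup (Fin (m + 1)) ℂ) : Set (CSpace m) :=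
  Matrix.toEuclideanLin (A : Matrix (Fin (m + 1)) (Fin (m + 1)) ℂ) ''
    {z : CSpace m | z 0 ∈ Metric.ball (0 : ℂ) r ∧
      (WithLp.toLp 2 fun i : Fin m => z i.succ : EuclideanSpace ℂ (Fin m)) ∈ Metric.ball 0 s}

/-- The translated cylinder `a + P_{r,s,A}`. -/
def holoCylinderAt {m : ℕ} (a : CSpace m) (r s : ℝ) (A : Matrix.unitaryGroup (Fin (m + 1)) ℂ) :
    Set (CSpace m) :=
  (fun z => a + z) '' holoCylinder r s A

/-- A function is pluriharmonic on `Ω` if it is of class `C²` there and its restriction to every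
complex line `{a + ζ b}` is harmonic on `{ζ ∈ ℂ | a + ζ b ∈ Ω}`. -/
def IsPluriharmonicOn {m : ℕ} (φ : CSpace m → ℝ) (Ω : Set (CSpace m)) : Prop :=
  ContDiffOn ℝ 2 φ Ω ∧
    ∀ a b : CSpace m, InnerProductSpace.HarmonicOnNhd (fun ζ : ℂ => φ (a + ζ • b))
      {ζ : ℂ | a + ζ • b ∈ Ω}

/-- The weighted integral `∫_D |f|² e^{-φ}`, as an element of `[0, ∞]`. -/
def weightedSqIntegral {m : ℕ} (φ : CSpace m → ℝ) (D : Set (CSpace m)) (f : CSpace m → ℂ) : ℝ≥0∞ :=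
  ∫⁻ z in D, ENNReal.ofReal (‖f z‖ ^ 2 * Real.exp (-φ z))

/-- The number `|P_{r,s,A}| e^{-φ(a)}`. -/
def extensionBound {m : ℕ} (φ : CSpace m → ℝ) (a : CSpace m) (r s : ℝ)
    (A : Matrix.unitaryGroup (Fin (m + 1)) ℂ) : ℝ≥0∞ :=
  volume (holoCylinder r s A) * ENNReal.ofReal (Real.exp (-φ a))

/-- `f` is holomorphic on `a + P_{r,s,A}`, `f a = 1`, and
`∫_{a + P_{r,s,A}} |f|² e^{-φ} ≤ |P_{r,s,A}| e^{-φ(a)}`. -/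
def IsOptimalExtension {m : ℕ} (φ : CSpace m → ℝ) (a : CSpace m) (r s : ℝ)
    (A : Matrix.unitaryGroup (Fin (m + 1)) ℂ) (f : CSpace m → ℂ) : Prop :=
  DifferentiableOn ℂ f (holoCylinderAt a r s A) ∧ f a = 1 ∧
    weightedSqIntegral φ (holoCylinderAt a r s A) f ≤ extensionBound φ a r s A

/-- The `L²`-extension index `L_φ(a,r,s,A)`: the infimum of
`(∫_{a + P_{r,s,A}} |f|² e^{-φ}) / (|P_{r,s,A}| e^{-φ(a)})` over the holomorphic functions `f` on
`a + P_{r,s,A}` with `∫ |f|² e^{-φ} < ∞` and `f a = 1` (it is `∞` if there are none). -/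
def extensionIndex {m : ℕ} (φ : CSpace m → ℝ) (a : CSpace m) (r s : ℝ)
    (A : Matrix.unitaryGroup (Fin (m + 1)) ℂ) : ℝ≥0∞ :=
  sInf {t : ℝ≥0∞ | ∃ f : CSpace m → ℂ,
    DifferentiableOn ℂ f (holoCylinderAt a r s A) ∧
    weightedSqIntegral φ (holoCylinderAt a r s A) f < ∞ ∧ f a = 1 ∧
    t = weightedSqIntegral φ (holoCylinderAt a r s A) f / extensionBound φ a r s A}

end

/-! If φ is pluriharmonic, then on a convex set φ = Re g with g holomorphic
(`IsPluriharmonicOn.exists_differentiableOn_re_eq`), and multiplication by exp((g(a) - g)/2) reduces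
everything to the weight 0. There the mean value property on cylinders makes u - 1 orthogonal to the
constants when u(a) = 1, so the constant 1 is the unique minimiser and its norm is the bound
(`volume_le_lintegral_norm_sq`). This gives existence, uniqueness, equality and index 1.

Conversely, existence and uniqueness force index 1: a competitor strictly below the bound could be
multiplied by 1 + εl, with l linear and l(a) = 0, giving two optimal extensions. If the index is 1,
let F be entire. Index ≥ 1, tested on exp((F - F(a))/2), gives the sub-mean value inequality for
exp(Re F - φ) on cylinders. Index ≤ 1, with the mean value property and Cauchy–Schwarz, gives it for
exp(φ - Re F). Letting s tend to 0 passes both to discs in complex lines, and the maximum principle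
shows that |φ - Re F| ≤ δ on a circle persists inside it. Since real parts of entire functions are
uniformly dense on the circle, φ equals its Poisson integral on each such disc and is harmonic
there. Regularity across lines comes from a radial mollifier, which reproduces φ up to a constant
factor (`contDiffAt_of_harmonicOnNhd_line`). -/

/-! ### Harmonicity and the maximum principle on the unit disc. -/

-- Trigonometric polynomials are dense, and on the circle negative powers of z are conjugates of
-- positive ones. Each is therefore P + conj Q with P and Q entire, and has the same real part as P
-- + Q.
open Metric InnerProductSpace in
theorem exists_differentiable_re_approx_of_continuousOn_sphere {g : ℂ → ℝ}
    (hg : ContinuousOn g (sphere 0 1)) {δ : ℝ} (hδ : 0 < δ) :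
    ∃ P : ℂ → ℂ, Differentiable ℂ P ∧ ∀ z ∈ sphere (0 : ℂ) 1, |g z - (P z).re| ≤ δ := by
  have : Fact ((0 : ℝ) < 1) := ⟨one_pos⟩
  have hcont : Continuous fun θ : AddCircle (1 : ℝ) => (g (AddCircle.toCircle θ) : ℂ) := by
    refine Complex.continuous_ofReal.comp (hg.comp_continuous ?_ ?_)
    · exact continuous_subtype_val.comp AddCircle.continuous_toCircle
    · intro θ
      simpa using Circle.norm_coe _
  let G : C(AddCircle (1 : ℝ), ℂ) := ⟨_, hcont⟩
  have hG : G ∈ (Submodule.span ℂ (Set.range (@fourier 1))).topologicalClosure := by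
    rw [span_fourier_closure_eq_top]; trivial
  obtain ⟨q, hq, hqG⟩ := Metric.mem_closure_iff.1 hG δ hδ
  have key : ∃ P Q : ℂ → ℂ, Differentiable ℂ P ∧ Differentiable ℂ Q ∧
      ∀ θ : AddCircle (1 : ℝ), q θ = P (AddCircle.toCircle θ)
        + (starRingEnd ℂ) (Q (AddCircle.toCircle θ)) := by
    clear hqG
    induction hq using Submodule.span_induction with
    | mem x hx =>
      obtain ⟨n, rfl⟩ := hx
      obtain ⟨k, rfl | rfl⟩ := n.eq_nat_or_neg
      · exact ⟨fun z => z ^ k, 0, by fun_prop, differentiable_const _, fun θ => by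
          simp [fourier_apply, AddCircle.toCircle_nsmul]⟩
      · refine ⟨0, fun z => z ^ k, differentiable_const _, by fun_prop, fun θ => ?_⟩
        simp [fourier_apply, AddCircle.toCircle_nsmul, AddCircle.toCircle_neg,
          ← Circle.coe_inv_eq_conj]
    | zero => exact ⟨0, 0, differentiable_const _, differentiable_const _, fun θ => by simp⟩
    | add x y _ _ hx hy =>
      obtain ⟨P, Q, hP, hQ, h⟩ := hx
      obtain ⟨P', Q', hP', hQ', h'⟩ := hy
      exact ⟨P + P', Q + Q', hP.add hP', hQ.add hQ', fun θ => by simp [h, h']; ring⟩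
    | smul c x _ hx =>
      obtain ⟨P, Q, hP, hQ, h⟩ := hx
      exact ⟨fun z => c * P z, fun z => (starRingEnd ℂ) c * Q z, hP.const_mul _, hQ.const_mul _,
        fun θ => by simp [h]; ring⟩
  obtain ⟨P, Q, hP, hQ, h⟩ := key
  refine ⟨P + Q, hP.add hQ, fun z hz => ?_⟩
  obtain ⟨θ, hθ⟩ := (AddCircle.homeomorphCircle (T := 1) one_ne_zero).surjective
    ⟨z, by simpa [Submonoid.unitSphere] using hz⟩
  rw [AddCircle.homeomorphCircle_apply] at hθ
  have hz' : (AddCircle.toCircle θ : ℂ) = z := by rw [hθ]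
  have h1 : ‖(G - q) θ‖ ≤ δ :=
    (ContinuousMap.norm_coe_le_norm _ θ).trans (by rw [← dist_eq_norm]; exact hqG.le)
  have h2 := (Complex.abs_re_le_norm _).trans h1
  have h3 : ((G - q) θ).re = g z - ((P + Q) z).re := by
    simp [G, h, hz']
  rwa [h3] at h2

-- Real parts of entire functions satisfy the Poisson formula. The hypothesis carries approximation
-- from the circle into the disc, so h satisfies it too, and a Poisson integral is the real part of
-- a holomorphic function.
open Metric InnerProductSpace Real in
theorem harmonicOnNhd_ball_of_approx {h : ℂ → ℝ} (hc : ContinuousOn h (closedBall 0 1))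
    (H : ∀ P : ℂ → ℂ, Differentiable ℂ P → ∀ δ : ℝ,
      (∀ z ∈ sphere (0 : ℂ) 1, |h z - (P z).re| ≤ δ) → ∀ z ∈ ball (0 : ℂ) 1, |h z - (P z).re| ≤ δ) :
    HarmonicOnNhd h (ball 0 1) := by
  have hs : ContinuousOn h (sphere 0 1) := hc.mono sphere_subset_closedBall
  have hint : CircleIntegrable h 0 1 := hs.circleIntegrable zero_le_one
  have hk : ∀ w ∈ ball (0 : ℂ) 1,
      h w = circleAverage ((Complex.re ∘ herglotzRieszKernel 0 w) • h) 0 1 := by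
    intro w hw
    have hkc : ContinuousOn (Complex.re ∘ herglotzRieszKernel 0 w) (sphere (0 : ℂ) 1) := by
      have := continuousOn_herglotzRieszKernel_sphere hw
      rw [abs_one] at this
      exact Complex.continuous_re.comp_continuousOn this
    obtain ⟨C, hC⟩ := (isCompact_sphere (0 : ℂ) 1).exists_bound_of_continuousOn hkc
    have hC0 : 0 ≤ C := (norm_nonneg _).trans (hC 1 (by simp))
    refine eq_of_abs_sub_le_all fun ε hε => ?_
    -- The pointwise error δ and the error Cδ of the kernel average add up to ε when δ = ε / (1 +
    -- C).
    obtain ⟨P, hP, hPδ⟩ := exists_differentiable_re_approx_of_continuousOn_sphere hs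
      (show 0 < ε / (1 + C) by positivity)
    have h1 := H P hP _ hPδ w hw
    have hPh : HarmonicOnNhd (fun z => (P z).re) (closedBall 0 1) := fun z _ =>
      (hP.analyticAt z).harmonicAt_re
    have h2 := hPh.circleAverage_re_herglotzRieszKernel_smul hw
    have hPc : ContinuousOn (fun z => (P z).re) (sphere 0 1) :=
      (Complex.continuous_re.comp hP.continuous).continuousOn
    have h3 : |circleAverage ((Complex.re ∘ herglotzRieszKernel 0 w) • h) 0 1
        - circleAverage ((Complex.re ∘ herglotzRieszKernel 0 w) • fun z => (P z).re) 0 1|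
        ≤ C * (ε / (1 + C)) := by
      rw [← circleAverage_sub ((hkc.smul hs).circleIntegrable zero_le_one)
        ((hkc.smul hPc).circleIntegrable zero_le_one)]
      refine (abs_circleAverage_le_circleAverage_abs).trans ?_
      refine circleAverage_mono_on_of_le_circle ?_ ?_
      · exact (((hkc.smul hs).sub (hkc.smul hPc)).abs).circleIntegrable zero_le_one
      · intro z hz
        rw [abs_one] at hz
        have := hC z hz
        rw [Real.norm_eq_abs] at this
        simp only [Pi.abs_apply, smul_eq_mul, ← mul_sub, Pi.mul_apply, Pi.sub_apply, abs_mul]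
        exact mul_le_mul this (hPδ z hz) (abs_nonneg _) hC0
    rw [h2] at h3
    rw [abs_sub_comm] at h3
    calc _ ≤ |h w - (P w).re| + |(P w).re - circleAverage ((Complex.re ∘ herglotzRieszKernel 0 w) • h) 0 1| :=
          abs_sub_le _ _ _
      _ ≤ ε / (1 + C) + C * (ε / (1 + C)) := add_le_add h1 h3
      _ = ε := by field_simp
  have hsC : ContinuousOn (fun z => (h z : ℂ)) (sphere 0 1) :=
    Complex.continuous_ofReal.comp_continuousOn hs
  have hintC : CircleIntegrable (fun z => (h z : ℂ)) 0 1 := hsC.circleIntegrable zero_le_one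
  have hF := (hasFPowerSeriesOn_cauchy_integral (R := 1) (by exact_mod_cast hintC) one_pos).analyticOnNhd
  set F : ℂ → ℂ := fun w => (2 * π * Complex.I : ℂ)⁻¹ • ∮ z in C(0, 1), (z - w)⁻¹ • (h z : ℂ) with hFdef
  have hF' : AnalyticOnNhd ℂ (fun w => 2 * F w - F 0) (ball 0 1) := by
    intro w hw
    have : AnalyticAt ℂ F w := hF w (by
      rw [Metric.mem_eball, edist_dist]
      simpa only [NNReal.coe_one, ENNReal.coe_one, ENNReal.ofReal_lt_one, mem_ball] using hw)
    exact (analyticAt_const.mul this).sub analyticAt_const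
  intro w hw
  refine (harmonicAt_congr_nhds ?_).1 (hF' w hw).harmonicAt_re
  filter_upwards [isOpen_ball.mem_nhds hw] with v hv
  rw [hk v hv, ← re_circleAverage_herglotzRieszKernel_smul hint hv,
    circleAverage_eq_circleIntegral one_ne_zero]
  congr 1
  have hne : ∀ z ∈ sphere (0 : ℂ) 1, z - v ≠ 0 := by
    intro z hz hzv
    rw [sub_eq_zero] at hzv
    simp only [mem_sphere, mem_ball, dist_zero_right] at hz hv
    rw [hzv] at hz; linarith
  have hne0 : ∀ z ∈ sphere (0 : ℂ) 1, z ≠ 0 := by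
    rintro z hz rfl
    simp at hz
  have e1 : CircleIntegrable (fun z => (z - v)⁻¹ • (h z : ℂ)) 0 1 :=
    (((continuousOn_id.sub continuousOn_const).inv₀ hne).smul hsC).circleIntegrable zero_le_one
  have e2 : CircleIntegrable (fun z => (z - 0)⁻¹ • (h z : ℂ)) 0 1 :=
    (((continuousOn_id.sub continuousOn_const).inv₀ (by simpa using hne0)).smul hsC).circleIntegrable zero_le_one
  -- Partial fractions: (z + v) / (z(z - v)) = 2/(z - v) - 1/z.
  have e3 : (∮ z in C(0, 1), (z - 0)⁻¹ • (herglotzRieszKernel 0 v z • (h z : ℂ)))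
      = 2 * (∮ z in C(0, 1), (z - v)⁻¹ • (h z : ℂ)) - ∮ z in C(0, 1), (z - 0)⁻¹ • (h z : ℂ) := by
    have e1' : CircleIntegrable (fun z => (2 : ℂ) * ((z - v)⁻¹ • (h z : ℂ))) 0 1 := by
      simpa [smul_eq_mul] using e1.const_fun_smul (a := (2 : ℂ))
    rw [← circleIntegral.integral_const_mul, ← circleIntegral.integral_sub e1' e2]
    refine circleIntegral.integral_congr zero_le_one fun z hz => ?_
    have a1 := hne z hz
    have a2 := hne0 z hz
    simp only [herglotzRieszKernel_def, sub_zero, smul_eq_mul]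
    field_simp
    ring
  rw [e3, hFdef]
  simp only [smul_eq_mul]
  ring

open Metric in
/-- Maximum principle for continuous functions with the area sub-mean value property. -/
theorem le_of_sub_mean_of_le_sphere {v : ℂ → ℝ} {M : ℝ} (hc : ContinuousOn v (closedBall 0 1))
    (hM : ∀ z ∈ sphere (0 : ℂ) 1, v z ≤ M)
    (hv : ∀ z r, 0 < r → closedBall z r ⊆ ball (0 : ℂ) 1 →
      volume.real (ball z r) * v z ≤ ∫ w in ball z r, v w) :
    ∀ z ∈ closedBall (0 : ℂ) 1, v z ≤ M := by
  obtain ⟨x, hx, hmax⟩ := (isCompact_closedBall (0 : ℂ) 1).exists_isMaxOn ⟨0, by simp⟩ hc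
  have hK : IsCompact (closedBall (0 : ℂ) 1 ∩ v ⁻¹' {v x}) :=
    (isCompact_closedBall (0 : ℂ) 1).of_isClosed_subset
      (hc.preimage_isClosed_of_isClosed isClosed_closedBall isClosed_singleton)
      Set.inter_subset_left
  -- Here y is a maximum point of largest modulus. Were it interior, the sub-mean value inequality
  -- would make v constant near y, producing a maximum point farther out.
  obtain ⟨y, ⟨hy, hyx⟩, hymax⟩ := hK.exists_isMaxOn ⟨x, hx, rfl⟩ continuous_norm.continuousOn
  have hyx : v y = v x := hyx
  suffices hys : y ∈ sphere (0 : ℂ) 1 from fun z hz => (hmax hz).trans (hyx ▸ hM y hys)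
  by_contra hys
  have hyb : ‖y‖ < 1 := by
    simp only [mem_closedBall, mem_sphere, dist_zero_right] at hy hys
    exact lt_of_le_of_ne hy hys
  set r := (1 - ‖y‖) / 2 with hr
  have hr0 : 0 < r := by rw [hr]; linarith
  have hsub : closedBall y r ⊆ ball (0 : ℂ) 1 := by
    intro z hz
    simp only [mem_closedBall, mem_ball, dist_zero_right] at hz ⊢
    have := norm_le_norm_add_norm_sub' z y
    rw [dist_eq_norm] at hz
    linarith
  have hvc : ContinuousOn v (closedBall y r) := hc.mono (hsub.trans ball_subset_closedBall)
  have hint : IntegrableOn v (ball y r) :=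
    (hvc.integrableOn_compact (isCompact_closedBall y r)).mono_set ball_subset_closedBall
  have hle : ∀ z ∈ ball y r, 0 ≤ v y - v z := fun z hz => by
    rw [hyx]
    exact sub_nonneg.2 (hmax (ball_subset_closedBall (hsub (ball_subset_closedBall hz))))
  have hfin : volume (ball y r) ≠ ∞ := measure_ball_lt_top.ne
  have hconst : IntegrableOn (fun _ => v y) (ball y r) := integrableOn_const hfin
  have h0 : ∫ w in ball y r, (v y - v w) = 0 := by
    refine le_antisymm ?_ (setIntegral_nonneg measurableSet_ball hle)
    rw [integral_sub hconst hint, setIntegral_const, smul_eq_mul]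
    linarith [hv y r hr0 hsub]
  have h1 : ∀ z ∈ ball y r, v y - v z = 0 := by
    have hae := (setIntegral_eq_zero_iff_of_nonneg_ae
      ((ae_restrict_iff' measurableSet_ball).2 (Filter.Eventually.of_forall hle))
      (hconst.sub hint)).1 h0
    have := Measure.eqOn_open_of_ae_eq hae isOpen_ball
      (continuousOn_const.sub (hvc.mono ball_subset_closedBall)) continuousOn_const
    exact fun z hz => this hz
  obtain ⟨z, hz, hzy⟩ : ∃ z ∈ ball y r, ‖y‖ < ‖z‖ := by
    rcases eq_or_ne y 0 with h | h
    · refine ⟨(r / 2 : ℝ), ?_, ?_⟩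
      · simp [h, abs_of_pos hr0, hr0]
      · simp [h, hr0.ne']
    · have hy0 : 0 < ‖y‖ := norm_pos_iff.2 h
      refine ⟨((1 + r / (2 * ‖y‖) : ℝ) : ℂ) * y, ?_, ?_⟩
      · rw [mem_ball, dist_eq_norm, show ((1 + r / (2 * ‖y‖) : ℝ) : ℂ) * y - y
          = ((r / (2 * ‖y‖) : ℝ) : ℂ) * y by push_cast; ring, norm_mul, Complex.norm_real,
          Real.norm_of_nonneg (by positivity)]
        field_simp
        linarith
      · rw [norm_mul, Complex.norm_real, Real.norm_of_nonneg (by positivity)]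
        have : 0 < r / (2 * ‖y‖) := by positivity
        nlinarith
  have hz' : z ∈ closedBall (0 : ℂ) 1 ∩ v ⁻¹' {v x} :=
    ⟨ball_subset_closedBall (hsub (ball_subset_closedBall hz)), by
      have := h1 z hz
      simp only [Set.mem_preimage, Set.mem_singleton_iff]; linarith⟩
  exact absurd (hymax hz') (not_le.2 hzy)

/-! ### Cylinders in product coordinates. -/

/-- The complex linear isomorphism `(ζ, w) ↦ A (ζ, w)` from `ℂ × ℂᵐ` onto `ℂᵐ⁺¹`. -/
noncomputable def cylinderEquiv {m : ℕ} (A : Matrix.unitaryGroup (Fin (m + 1)) ℂ) :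
    (ℂ × EuclideanSpace ℂ (Fin m)) ≃L[ℂ] CSpace m :=
  LinearEquiv.toContinuousLinearEquiv
    { toFun := fun p => Matrix.toEuclideanLin (A : Matrix (Fin (m + 1)) (Fin (m + 1)) ℂ)
        (WithLp.toLp 2 (Fin.cons p.1 p.2))
      invFun := fun z =>
        let y : CSpace m :=
          Matrix.toEuclideanLin (star A : Matrix (Fin (m + 1)) (Fin (m + 1)) ℂ) z
        (y 0, WithLp.toLp 2 fun i => y i.succ)
      map_add' := fun p q => by
        rw [← map_add]; congr 1; ext i; refine Fin.cases ?_ (fun j => ?_) i <;> simp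
      map_smul' := fun c p => by
        rw [← map_smul]; congr 1; ext i; refine Fin.cases ?_ (fun j => ?_) i <;> simp
      left_inv := fun p => by
        have : (star A : Matrix (Fin (m + 1)) (Fin (m + 1)) ℂ) * A = 1 :=
          (Matrix.mem_unitaryGroup_iff').1 A.2
        simp [Matrix.toEuclideanLin, Matrix.toLpLin_apply, this]
      right_inv := fun z => by
        have : (A : Matrix (Fin (m + 1)) (Fin (m + 1)) ℂ) * star (A : Matrix _ _ ℂ) = 1 :=
          (Matrix.mem_unitaryGroup_iff).1 A.2
        ext i
        simp only [Matrix.toEuclideanLin, Matrix.toLpLin_apply]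
        rw [show (Fin.cons (((star (A : Matrix (Fin (m + 1)) (Fin (m + 1)) ℂ)).mulVec z.ofLp) 0)
          fun i : Fin m => ((star (A : Matrix (Fin (m + 1)) (Fin (m + 1)) ℂ)).mulVec z.ofLp) i.succ)
          = ((star (A : Matrix (Fin (m + 1)) (Fin (m + 1)) ℂ)).mulVec z.ofLp) from
            Fin.cons_self_tail _]
        simp [this] }

theorem cylinderEquiv_apply {m : ℕ} (A : Matrix.unitaryGroup (Fin (m + 1)) ℂ)
    (p : ℂ × EuclideanSpace ℂ (Fin m)) :
    cylinderEquiv A p = Matrix.toEuclideanLin (A : Matrix (Fin (m + 1)) (Fin (m + 1)) ℂ)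
        (WithLp.toLp 2 (Fin.cons p.1 p.2)) := rfl

open Metric in
theorem holoCylinder_eq_image {m : ℕ} (r s : ℝ) (A : Matrix.unitaryGroup (Fin (m + 1)) ℂ) :
    holoCylinder r s A = cylinderEquiv A '' (ball 0 r ×ˢ ball 0 s) := by
  ext z
  constructor
  · rintro ⟨y, ⟨h1, h2⟩, rfl⟩
    refine ⟨(y 0, WithLp.toLp 2 fun i => y i.succ), ⟨h1, h2⟩, ?_⟩
    rw [cylinderEquiv_apply]
    congr 1
    ext i
    refine Fin.cases ?_ (fun j => ?_) i <;> simp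
  · rintro ⟨p, ⟨h1, h2⟩, rfl⟩
    exact ⟨_, ⟨by simpa using h1, by simpa using h2⟩, rfl⟩

/-- Completing b to an orthonormal basis gives the columns of A. Thus every complex direction is the
disc axis of some cylinder. -/
theorem exists_cylinderEquiv_apply_eq {m : ℕ} {b : CSpace m} (hb : ‖b‖ = 1) :
    ∃ A : Matrix.unitaryGroup (Fin (m + 1)) ℂ, cylinderEquiv A (1, 0) = b := by
  have ho : Orthonormal ℂ (Set.domRestrict ({0} : Set (Fin (m + 1))) (fun _ => b)) := by
    rw [orthonormal_iff_ite]
    rintro ⟨i, hi⟩ ⟨j, hj⟩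
    simp only [Set.mem_singleton_iff] at hi hj
    subst hi hj
    simp [hb]
  obtain ⟨u, hu⟩ := ho.exists_orthonormalBasis_extension_of_card_eq (by simp)
  refine ⟨⟨_, (EuclideanSpace.basisFun (Fin (m + 1)) ℂ).toMatrix_orthonormalBasis_mem_unitary u⟩, ?_⟩
  rw [cylinderEquiv_apply]
  ext i
  rw [← hu 0 rfl]
  simp [Matrix.toEuclideanLin, Matrix.toLpLin_apply, Matrix.mulVec, dotProduct, Fin.sum_univ_succ,
    Module.Basis.toMatrix_apply]

section Cylinder

variable {m : ℕ} {r s : ℝ} {a : CSpace m} {A : Matrix.unitaryGroup (Fin (m + 1)) ℂ}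

open Metric Pointwise

theorem isOpen_holoCylinder : IsOpen (holoCylinder r s A) := by
  rw [holoCylinder_eq_image]
  exact (cylinderEquiv A).toHomeomorph.isOpenMap _ (isOpen_ball.prod isOpen_ball)

theorem convex_holoCylinder : Convex ℝ (holoCylinder r s A) := by
  rw [holoCylinder_eq_image]
  exact ((convex_ball _ _).prod (convex_ball _ _)).linear_image
    ((cylinderEquiv A).toLinearMap.restrictScalars ℝ)

theorem zero_mem_holoCylinder (hr : 0 < r) (hs : 0 < s) : (0 : CSpace m) ∈ holoCylinder r s A := by
  rw [holoCylinder_eq_image]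
  exact ⟨0, ⟨by simpa using hr, by simpa using hs⟩, map_zero _⟩

/-- Balancedness is what lets the mean value property be proved by averaging over circles ζ ↦ ζw. -/
theorem smul_mem_holoCylinder {c : ℂ} (hc : ‖c‖ ≤ 1) {w : CSpace m} (hw : w ∈ holoCylinder r s A) :
    c • w ∈ holoCylinder r s A := by
  rw [holoCylinder_eq_image] at hw ⊢
  obtain ⟨p, ⟨h1, h2⟩, rfl⟩ := hw
  refine ⟨c • p, ⟨?_, ?_⟩, map_smul _ _ _⟩
  · simp only [mem_ball, dist_zero_right, Prod.smul_fst, norm_smul] at h1 ⊢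
    nlinarith [norm_nonneg p.1]
  · simp only [mem_ball, dist_zero_right, Prod.smul_snd, norm_smul] at h2 ⊢
    nlinarith [norm_nonneg p.2]

theorem isBounded_holoCylinder : Bornology.IsBounded (holoCylinder r s A) := by
  rw [holoCylinder_eq_image]
  exact ((cylinderEquiv A).lipschitz).isBounded_image (isBounded_ball.prod isBounded_ball)

theorem add_mem_holoCylinderAt_iff {w : CSpace m} :
    a + w ∈ holoCylinderAt a r s A ↔ w ∈ holoCylinder r s A := by
  simp [holoCylinderAt]

theorem self_mem_holoCylinderAt (hr : 0 < r) (hs : 0 < s) : a ∈ holoCylinderAt a r s A :=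
  ⟨0, zero_mem_holoCylinder hr hs, add_zero a⟩

theorem isOpen_holoCylinderAt : IsOpen (holoCylinderAt a r s A) :=
  isOpen_holoCylinder.vadd a

theorem convex_holoCylinderAt : Convex ℝ (holoCylinderAt a r s A) :=
  convex_holoCylinder.vadd a

theorem volume_holoCylinderAt : volume (holoCylinderAt a r s A) = volume (holoCylinder r s A) :=
  measure_vadd volume a _

theorem volume_holoCylinder_ne_top : volume (holoCylinder r s A) ≠ ∞ :=
  isBounded_holoCylinder.measure_lt_top.ne

theorem volume_holoCylinder_pos (hr : 0 < r) (hs : 0 < s) : 0 < volume (holoCylinder r s A) :=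
  isOpen_holoCylinder.measure_pos _ ⟨0, zero_mem_holoCylinder hr hs⟩

/-- Uniqueness of Haar measure up to a factor. The value of c is irrelevant, since it cancels when
an integral is compared with a volume. -/
theorem exists_setIntegral_holoCylinderAt (A : Matrix.unitaryGroup (Fin (m + 1)) ℂ) :
    ∃ c : ℝ, 0 < c ∧ ∀ (a : CSpace m) (r s : ℝ) (g : CSpace m → ℝ),
      ∫ z in holoCylinderAt a r s A, g z
        = c * ∫ p in ball (0 : ℂ) r ×ˢ ball (0 : EuclideanSpace ℂ (Fin m)) s,
            g (a + cylinderEquiv A p) ∂((volume : Measure ℂ).prod volume) := by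
  let ν : Measure (ℂ × EuclideanSpace ℂ (Fin m)) := (volume : Measure ℂ).prod volume
  let μ : Measure (CSpace m) := Measure.map (cylinderEquiv A) ν
  have hμ : μ.IsAddHaarMeasure := (cylinderEquiv A).isAddHaarMeasure_map ν
  obtain ⟨k, h⟩ : ∃ k : NNReal, (volume : Measure (CSpace m)) = k • μ :=
    ⟨_, Measure.isAddLeftInvariant_eq_smul (volume : Measure (CSpace m)) μ⟩
  have hk : k ≠ 0 := by
    rintro rfl
    rw [zero_smul] at h
    exact (NeZero.ne (volume : Measure (CSpace m))) h
  refine ⟨k, NNReal.coe_pos.2 (pos_iff_ne_zero.2 hk), fun a r s g => ?_⟩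
  have h1 : ∫ z in holoCylinderAt a r s A, g z = ∫ w in holoCylinder r s A, g (a + w) := by
    have := (measurePreserving_add_left (volume : Measure (CSpace m)) a).setIntegral_preimage_emb
      (measurableEmbedding_addLeft a) g (holoCylinderAt a r s A)
    rw [← this]
    congr 2
    ext w
    exact add_mem_holoCylinderAt_iff
  have h2 : (cylinderEquiv A) ⁻¹' (holoCylinder r s A) = ball (0 : ℂ) r ×ˢ ball 0 s := by
    rw [holoCylinder_eq_image]
    exact Set.preimage_image_eq _ (cylinderEquiv A).injective
  rw [h1, h, Measure.restrict_smul, integral_smul_nnreal_measure]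
  have h3 := (cylinderEquiv A).toHomeomorph.measurableEmbedding.setIntegral_map (μ := ν)
    (fun w => g (a + w)) (holoCylinder r s A)
  simp only [ContinuousLinearEquiv.coe_toHomeomorph, h2] at h3
  rw [h3, NNReal.smul_def, smul_eq_mul]

/-! ### Shrinking a cylinder to its central disc. -/

/-- A tube-lemma argument: compactness makes the comparison with the central slice uniform in x. -/
theorem eventually_forall_lt_add_of_isCompact {X Y : Type*} [TopologicalSpace X]
    [TopologicalSpace Y] {U : Set (X × Y)} (hU : IsOpen U) {G : X × Y → ℝ} (hG : ContinuousOn G U)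
    {K : Set X} (hK : IsCompact K) {y₀ : Y} (hKU : ∀ x ∈ K, (x, y₀) ∈ U) {η : ℝ} (hη : 0 < η) :
    ∀ᶠ y in nhds y₀, ∀ x ∈ K, (x, y) ∈ U ∧ G (x, y) < G (x, y₀) + η := by
  refine hK.eventually_forall_of_forall_eventually fun x hx => ?_
  have hmem : (x, y₀) ∈ U := hKU x hx
  have hGx : ContinuousAt G (x, y₀) := hG.continuousAt (hU.mem_nhds hmem)
  have t1 : Filter.Tendsto (fun p : Y × X => (p.2, p.1)) (nhds (y₀, x)) (nhds (x, y₀)) :=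
    (continuous_snd.prodMk continuous_fst).tendsto _
  have t2 : Filter.Tendsto (fun p : Y × X => (p.2, y₀)) (nhds (y₀, x)) (nhds (x, y₀)) :=
    (continuous_snd.prodMk continuous_const).tendsto _
  exact (t1.eventually_mem (hU.mem_nhds hmem)).and
    ((hGx.tendsto.comp t1).eventually_lt ((hGx.tendsto.comp t2).add_const η) (by simpa using hη))

/-- A sub-mean value inequality on all thin cylinders passes to the central disc. -/
theorem sub_mean_disc_of_sub_mean_holoCylinderAt {Ω : Set (CSpace m)} (hΩ : IsOpen Ω)
    {g : CSpace m → ℝ} (hg : ContinuousOn g Ω) (hr : 0 < r)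
    (hsub : ∀ ζ ∈ closedBall (0 : ℂ) r, a + ζ • cylinderEquiv A (1, 0) ∈ Ω)
    (h : ∀ s, 0 < s → holoCylinderAt a r s A ⊆ Ω →
      volume.real (holoCylinderAt a r s A) * g a ≤ ∫ z in holoCylinderAt a r s A, g z) :
    volume.real (ball (0 : ℂ) r) * g a
      ≤ ∫ ζ in ball (0 : ℂ) r, g (a + ζ • cylinderEquiv A (1, 0)) := by
  set T := cylinderEquiv A with hT
  have hT1 : ∀ ζ : ℂ, ζ • T (1, 0) = T (ζ, 0) := fun ζ => by
    rw [← map_smul]; simp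
  simp only [hT1] at hsub ⊢
  set U : Set (ℂ × EuclideanSpace ℂ (Fin m)) := (fun p => a + T p) ⁻¹' Ω with hU
  have hTc : Continuous fun p => a + T p := continuous_const.add T.continuous
  have hUo : IsOpen U := hΩ.preimage hTc
  have hG : ContinuousOn (fun p => g (a + T p)) U := hg.comp hTc.continuousOn fun p hp => hp
  have hG0 : ContinuousOn (fun ζ : ℂ => g (a + T (ζ, 0))) (closedBall 0 r) :=
    hG.comp (f := fun ζ : ℂ => ((ζ, 0) : ℂ × EuclideanSpace ℂ (Fin m))) (by fun_prop) hsub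
  have hv0 : 0 < volume.real (ball (0 : ℂ) r) :=
    ENNReal.toReal_pos (isOpen_ball.measure_pos _ (nonempty_ball.2 hr)).ne' measure_ball_lt_top.ne
  refine le_of_forall_pos_le_add fun ε hε => ?_
  set η := ε / volume.real (ball (0 : ℂ) r) with hη
  have hη0 : 0 < η := by positivity
  have hev := eventually_forall_lt_add_of_isCompact hUo hG (isCompact_closedBall (0 : ℂ) r)
    (y₀ := 0) hsub hη0
  obtain ⟨s₀, hs₀, hs⟩ := Metric.eventually_nhds_iff_ball.1 hev
  set s := s₀ / 2 with hsdef
  have hs0 : 0 < s := by positivity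
  have hcb : ∀ w ∈ closedBall (0 : EuclideanSpace ℂ (Fin m)) s, w ∈ ball 0 s₀ := fun w hw =>
    closedBall_subset_ball (by rw [hsdef]; linarith) hw
  have hsubU : closedBall (0 : ℂ) r ×ˢ closedBall (0 : EuclideanSpace ℂ (Fin m)) s ⊆ U :=
    fun p hp => (hs p.2 (hcb _ hp.2) p.1 hp.1).1
  have hint : IntegrableOn (fun p => g (a + T p)) (ball (0 : ℂ) r ×ˢ ball 0 s)
      ((volume : Measure ℂ).prod volume) :=
    ((hG.mono hsubU).integrableOn_compact ((isCompact_closedBall _ _).prod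
      (isCompact_closedBall _ _))).mono_set
      (Set.prod_mono ball_subset_closedBall ball_subset_closedBall)
  have hint0 : IntegrableOn (fun ζ : ℂ => g (a + T (ζ, 0)) + η) (ball (0 : ℂ) r) :=
    ((hG0.add continuousOn_const).integrableOn_compact (isCompact_closedBall _ _)).mono_set
      ball_subset_closedBall
  have hint0' : IntegrableOn (fun ζ : ℂ => g (a + T (ζ, 0))) (ball (0 : ℂ) r) :=
    (hG0.integrableOn_compact (isCompact_closedBall _ _)).mono_set ball_subset_closedBall
  have hvB : 0 < volume.real (ball (0 : EuclideanSpace ℂ (Fin m)) s) :=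
    ENNReal.toReal_pos (isOpen_ball.measure_pos _ (nonempty_ball.2 hs0)).ne' measure_ball_lt_top.ne
  have hsubΩ : holoCylinderAt a r s A ⊆ Ω := by
    rintro _ ⟨z, hz, rfl⟩
    rw [holoCylinder_eq_image] at hz
    obtain ⟨p, hp, rfl⟩ := hz
    exact hsubU ⟨ball_subset_closedBall hp.1, ball_subset_closedBall hp.2⟩
  have hmain := h s hs0 hsubΩ
  obtain ⟨c, hc, hcyl⟩ := exists_setIntegral_holoCylinderAt A
  have hvol := hcyl a r s (fun _ => 1)
  rw [setIntegral_const, setIntegral_const, smul_eq_mul, mul_one, smul_eq_mul, mul_one,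
    measureReal_prod_prod] at hvol
  rw [hcyl, hvol] at hmain
  -- On a thin cylinder g exceeds its value on the central disc by less than η, so Fubini splits off
  -- the volume of the small ball. That volume then cancels, and η costs exactly ε over the disc.
  have hle : ∫ p in ball (0 : ℂ) r ×ˢ ball (0 : EuclideanSpace ℂ (Fin m)) s, g (a + T p)
        ∂((volume : Measure ℂ).prod volume)
      ≤ (∫ ζ in ball (0 : ℂ) r, (g (a + T (ζ, 0)) + η))
        * volume.real (ball (0 : EuclideanSpace ℂ (Fin m)) s) := by
    have e := setIntegral_prod_mul (μ := (volume : Measure ℂ))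
      (ν := (volume : Measure (EuclideanSpace ℂ (Fin m))))
      (fun ζ : ℂ => g (a + T (ζ, 0)) + η) (fun _ => (1 : ℝ)) (ball 0 r) (ball 0 s)
    rw [setIntegral_const, smul_eq_mul, mul_one] at e
    rw [← e]
    refine setIntegral_mono_on hint ?_ (measurableSet_ball.prod measurableSet_ball) ?_
    · rw [IntegrableOn, ← Measure.prod_restrict]
      exact hint0.mul_prod (integrableOn_const measure_ball_lt_top.ne)
    · intro p hp
      rw [mul_one]
      exact (hs p.2 (hcb _ (ball_subset_closedBall hp.2)) p.1 (ball_subset_closedBall hp.1)).2.le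
  have hfin : volume.real (ball (0 : ℂ) r) * g a
      ≤ ∫ ζ in ball (0 : ℂ) r, (g (a + T (ζ, 0)) + η) := by
    have := hmain.trans (mul_le_mul_of_nonneg_left hle hc.le)
    refine le_of_mul_le_mul_right (a := c * volume.real (ball (0 : EuclideanSpace ℂ (Fin m)) s)) ?_
      (by positivity)
    linarith
  rw [integral_add hint0' (integrableOn_const measure_ball_lt_top.ne), setIntegral_const,
    smul_eq_mul, hη, mul_div_cancel₀ _ hv0.ne'] at hfin
  exact hfin

end Cylinder

/-! ### Pluriharmonic functions as real parts. -/

section Pluriharmonic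

variable {m : ℕ} {φ : CSpace m → ℝ} {Ω : Set (CSpace m)}

-- By the chain rule the left side is the Laplacian at ζ = 0 of ζ ↦ φ(a + ζv).
open InnerProductSpace in
theorem fderiv_fderiv_add_fderiv_fderiv_I_smul_eq_zero (hΩ : IsOpen Ω) (hφ : IsPluriharmonicOn φ Ω)
    {a : CSpace m} (ha : a ∈ Ω) (v : CSpace m) :
    fderiv ℝ (fderiv ℝ φ) a v v
      + fderiv ℝ (fderiv ℝ φ) a (Complex.I • v) (Complex.I • v) = 0 := by
  have hC : ∀ x ∈ Ω, ContDiffAt ℝ 2 φ x := fun x hx => hφ.1.contDiffAt (hΩ.mem_nhds hx)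
  let l : ℂ →L[ℝ] CSpace m :=
    ((ContinuousLinearMap.id ℂ ℂ).smulRight v).restrictScalars ℝ
  have hl : ∀ ζ, l ζ = ζ • v := fun ζ => rfl
  have hp : ∀ (L : CSpace m →L[ℝ] ℝ) ζ, ContinuousLinearMap.precomp ℝ l L ζ = L (ζ • v) :=
    fun L ζ => rfl
  have hl' : ∀ ζ, HasFDerivAt (fun ζ : ℂ => a + ζ • v) l ζ := fun ζ => l.hasFDerivAt.const_add a
  have hcont : Continuous fun ζ : ℂ => a + ζ • v := by fun_prop
  have hd1 : ∀ᶠ ζ in nhds (0 : ℂ), fderiv ℝ (fun ζ : ℂ => φ (a + ζ • v)) ζ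
      = ContinuousLinearMap.precomp ℝ l (fderiv ℝ φ (a + ζ • v)) := by
    have : ∀ᶠ ζ in nhds (0 : ℂ), a + ζ • v ∈ Ω :=
      hcont.continuousAt.eventually_mem (hΩ.mem_nhds (by simpa using ha))
    filter_upwards [this] with ζ hζ
    exact (((hC _ hζ).differentiableAt two_ne_zero).hasFDerivAt.comp ζ (hl' ζ)).fderiv
  have hd2 : HasFDerivAt (fun ζ : ℂ => ContinuousLinearMap.precomp ℝ l (fderiv ℝ φ (a + ζ • v)))
      ((ContinuousLinearMap.precomp ℝ l).comp ((fderiv ℝ (fderiv ℝ φ) a).comp l)) 0 := by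
    refine (ContinuousLinearMap.precomp ℝ l).hasFDerivAt.comp 0 ?_
    refine HasFDerivAt.comp (g := fderiv ℝ φ) (0 : ℂ) ?_ (hl' 0)
    rw [zero_smul, add_zero]
    have h1 : ContDiffAt ℝ 1 (fderiv ℝ φ) a := (hC a ha).fderiv_right (by norm_num)
    exact (h1.differentiableAt one_ne_zero).hasFDerivAt
  have hharm := (hφ.2 a v 0 (by simpa using ha)).2.self_of_nhds
  rw [laplacian_eq_iteratedFDeriv_complexPlane] at hharm
  simp only [iteratedFDeriv_two_apply, Matrix.cons_val_zero, Matrix.cons_val_one,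
    Filter.EventuallyEq.fderiv_eq hd1, hd2.fderiv] at hharm
  simpa [hl, hp] using hharm

/-- A pluriharmonic function is the real part of a holomorphic function on every convex open
subset. -/
theorem IsPluriharmonicOn.exists_differentiableOn_re_eq (hΩ : IsOpen Ω)
    (hφ : IsPluriharmonicOn φ Ω) {D : Set (CSpace m)} (hD : Convex ℝ D) (hDo : IsOpen D)
    (hDΩ : D ⊆ Ω) :
    ∃ g : CSpace m → ℂ, DifferentiableOn ℂ g D ∧ ∀ z ∈ D, (g z).re = φ z := by
  have hC : ∀ x ∈ Ω, ContDiffAt ℝ 2 φ x := fun x hx => hφ.1.contDiffAt (hΩ.mem_nhds hx)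
  -- Λ sends L to the complex-linear functional with real part L, so Λ(dφ) = 2∂φ is the derivative
  -- that g must have. Its closedness is the symmetry condition checked below.
  let Λ : (CSpace m →L[ℝ] ℝ) →L[ℝ] (CSpace m →L[ℝ] ℂ) :=
    (ContinuousLinearMap.restrictScalarsL ℂ (CSpace m) ℂ ℝ ℝ).comp
      (StrongDual.extendRCLikeₗᵢ (𝕜 := ℂ) (F := CSpace m)).toContinuousLinearEquiv.toContinuousLinearMap
  have hΛ : ∀ L x, Λ L x = (L x : ℂ) - Complex.I * (L (Complex.I • x) : ℂ) := fun L x => rfl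
  have hΛr : ∀ L, ∃ L' : CSpace m →L[ℂ] ℂ, L'.restrictScalars ℝ = Λ L := fun L =>
    ⟨StrongDual.extendRCLike L, rfl⟩
  have h1 : ∀ z ∈ D, DifferentiableAt ℝ (fderiv ℝ φ) z := fun z hz =>
    ((hC z (hDΩ hz)).fderiv_right (m := 1) (by norm_num)).differentiableAt one_ne_zero
  have h2 : ∀ z ∈ D, HasFDerivAt (fun z => Λ (fderiv ℝ φ z)) (Λ.comp (fderiv ℝ (fderiv ℝ φ) z)) z :=
    fun z hz => Λ.hasFDerivAt.comp z (h1 z hz).hasFDerivAt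
  obtain ⟨g, hg⟩ := hD.exists_forall_hasFDerivAt_of_fderiv_symmetric (𝕜 := ℝ) hDo
    (ω := fun z => Λ (fderiv ℝ φ z))
    (fun z hz => (h2 z hz).differentiableAt.differentiableWithinAt) (by
      intro z hz x y
      rw [(h2 z hz).fderiv]
      simp only [ContinuousLinearMap.comp_apply, hΛ]
      set B := fderiv ℝ (fderiv ℝ φ) z with hB
      have hsymm : ∀ u v, B u v = B v u := fun u v =>
        ((hC z (hDΩ hz)).isSymmSndFDerivAt (by simp)) u v
      have hq := fun v => fderiv_fderiv_add_fderiv_fderiv_I_smul_eq_zero hΩ hφ (hDΩ hz) v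
      rw [← hB] at hq
      -- Polarisation of the diagonal identity at x + iy.
      have hpol : B x (Complex.I • y) = B y (Complex.I • x) := by
        have e1 := hq (x + Complex.I • y)
        have e2 := hq x
        have e3 := hq (Complex.I • y)
        have hII : Complex.I • Complex.I • y = -y := by
          rw [smul_smul, Complex.I_mul_I, neg_one_smul]
        simp only [smul_add, map_add, add_apply, hII, map_neg,
          neg_apply, neg_neg] at e1 e2 e3
        have s1 := hsymm x (Complex.I • y)
        have s2 := hsymm (Complex.I • x) y
        linarith
      rw [hsymm x y, hpol])
  have hgR : DifferentiableOn ℝ (fun z => (g z).re) D := fun z hz =>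
    (Complex.reCLM.hasFDerivAt.comp z (hg z hz)).differentiableAt.differentiableWithinAt
  have hφD : DifferentiableOn ℝ φ D := fun z hz =>
    ((hC z (hDΩ hz)).differentiableAt two_ne_zero).differentiableWithinAt
  obtain ⟨c, hc⟩ := hDo.exists_is_const_of_fderiv_eq_zero (𝕜 := ℝ) hD.isPreconnected
    (hφD.sub hgR) (by
      intro z hz
      have := ((hC z (hDΩ hz)).differentiableAt two_ne_zero).hasFDerivAt.sub
        (Complex.reCLM.hasFDerivAt.comp z (hg z hz))
      have h := this.fderiv
      refine h.trans ?_
      ext x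
      simp [hΛ])
  -- Re g has the same derivative as φ, hence the constant c; g is holomorphic because its real
  -- derivative is complex linear.
  refine ⟨fun z => g z + c, fun z hz => ?_, fun z hz => ?_⟩
  · refine DifferentiableAt.differentiableWithinAt (DifferentiableAt.add_const _ ?_)
    rw [differentiableAt_iff_restrictScalars ℝ (hg z hz).differentiableAt, (hg z hz).fderiv]
    exact hΛr _
  · have := hc z hz
    simp only [Pi.sub_apply] at this
    simp [← this]

end Pluriharmonic

/-! ### Circle averages and the mean value property on cylinders. -/

section MeanValue

variable {m : ℕ}

open Real

theorem measurePreserving_const_smul_of_norm_eq_one {c : ℂ} (hc : ‖c‖ = 1) :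
    MeasurePreserving (fun w : CSpace m => c • w) := by
  have hc0 : c ≠ 0 := norm_ne_zero_iff.1 (by rw [hc]; exact one_ne_zero)
  let e : CSpace m ≃ₗᵢ[ℝ] CSpace m :=
    { (LinearEquiv.smulOfNeZero ℂ (CSpace m) c hc0).restrictScalars ℝ with
      norm_map' := fun w => by
        change ‖c • w‖ = ‖w‖
        rw [norm_smul, hc, one_mul] }
  exact e.measurePreserving

/-- The integral of a function is the integral of its averages over the orbits of the circle
action `w ↦ e^{iθ} w`. -/
theorem integral_eq_integral_circleAverage {F : Type*} [NormedAddCommGroup F] [NormedSpace ℝ F]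
    [CompleteSpace F] {G : CSpace m → F} (hG : Integrable G) :
    ∫ w, G w = ∫ w, circleAverage (fun ζ => G (ζ • w)) 0 1 := by
  have hmap : ∀ θ, MeasurePreserving (fun w : CSpace m => circleMap 0 1 θ • w) := fun θ =>
    measurePreserving_const_smul_of_norm_eq_one (by simp [circleMap])
  have hc : Continuous fun p : ℝ × CSpace m => circleMap 0 1 p.1 • p.2 := by
    have : Continuous fun p : ℝ × CSpace m => circleMap 0 1 p.1 :=
      (continuous_circleMap 0 1).comp continuous_fst
    exact this.smul continuous_snd
  -- Rotating each fibre preserves the product measure, which supplies the joint integrability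
  -- needed for Fubini.
  have hskew : MeasurePreserving (fun p : ℝ × CSpace m => (p.1, circleMap 0 1 p.1 • p.2))
      ((volume.restrict (Set.Ioc 0 (2 * π))).prod volume)
      ((volume.restrict (Set.Ioc 0 (2 * π))).prod volume) :=
    (MeasurePreserving.id _).skew_product (g := fun θ w => circleMap 0 1 θ • w)
      hc.measurable (Filter.Eventually.of_forall fun θ => (hmap θ).map_eq)
  have hint : Integrable (fun p : ℝ × CSpace m => G (circleMap 0 1 p.1 • p.2))
      ((volume.restrict (Set.Ioc 0 (2 * π))).prod volume) :=
    hskew.integrable_comp_of_integrable (g := fun p : ℝ × CSpace m => G p.2) (hG.comp_snd _)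
  have hswap : ∫ w, ∫ θ in Set.Ioc 0 (2 * π), G (circleMap 0 1 θ • w)
      = ∫ θ in Set.Ioc 0 (2 * π), ∫ w, G (circleMap 0 1 θ • w) :=
    (integral_integral_swap (f := fun θ w => G (circleMap 0 1 θ • w)) hint).symm
  have hconst : ∀ θ, ∫ w, G (circleMap 0 1 θ • w) = ∫ w, G w := fun θ =>
    (hmap θ).integral_comp' (f := (Homeomorph.smulOfNeZero (circleMap 0 1 θ)
      (by simp [circleMap])).toMeasurableEquiv) G
  simp only [circleAverage_def, intervalIntegral.integral_of_le two_pi_pos.le]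
  rw [integral_smul, hswap]
  simp only [hconst]
  rw [setIntegral_const, smul_smul, volume_real_Ioc_of_le two_pi_pos.le, sub_zero,
    inv_mul_cancel₀ two_pi_pos.ne', one_smul]

open Metric in
/-- The mean value property of integrable holomorphic functions on cylinders. -/
theorem setIntegral_holoCylinderAt_eq {a : CSpace m} {r s : ℝ}
    {A : Matrix.unitaryGroup (Fin (m + 1)) ℂ} {u : CSpace m → ℂ}
    (hu : DifferentiableOn ℂ u (holoCylinderAt a r s A))
    (hint : IntegrableOn u (holoCylinderAt a r s A)) :
    ∫ z in holoCylinderAt a r s A, u z = volume.real (holoCylinderAt a r s A) • u a := by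
  set P := holoCylinder r s A with hP
  have hPm : MeasurableSet P := isOpen_holoCylinder.measurableSet
  have hpre : (fun w => a + w) ⁻¹' holoCylinderAt a r s A = P :=
    Set.ext fun w => add_mem_holoCylinderAt_iff
  have hmp := measurePreserving_add_left (volume : Measure (CSpace m)) a
  have h1 : ∫ z in holoCylinderAt a r s A, u z = ∫ w in P, u (a + w) := by
    rw [← hmp.setIntegral_preimage_emb (measurableEmbedding_addLeft a), hpre]
  have hint' : IntegrableOn (fun w => u (a + w)) P := by
    rw [← hpre]
    exact (hmp.integrableOn_comp_preimage (measurableEmbedding_addLeft a)).2 hint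
  -- Each circle orbit lies wholly inside or wholly outside P. Inside, the closed disc it bounds
  -- stays in P, and the one-variable mean value is u(a).
  have h2 : ∀ w, circleAverage (fun ζ : ℂ => P.indicator (fun w => u (a + w)) (ζ • w)) 0 1
      = P.indicator (fun _ => u a) w := by
    intro w
    have hmem : ∀ ζ ∈ sphere (0 : ℂ) |1|, (ζ • w ∈ P ↔ w ∈ P) := by
      intro ζ hζ
      have hζ1 : ‖ζ‖ = 1 := by simpa using hζ
      refine ⟨fun h => ?_, smul_mem_holoCylinder hζ1.le⟩
      have hne : ζ ≠ 0 := norm_ne_zero_iff.1 (by rw [hζ1]; exact one_ne_zero)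
      have := smul_mem_holoCylinder (c := ζ⁻¹) (by rw [norm_inv, hζ1, inv_one]) h
      rwa [smul_smul, inv_mul_cancel₀ hne, one_smul] at this
    by_cases hw : w ∈ P
    · rw [Set.indicator_of_mem hw]
      rw [circleAverage_congr_sphere (f₂ := fun ζ : ℂ => u (a + ζ • w))
        fun ζ hζ => Set.indicator_of_mem ((hmem ζ hζ).2 hw) _]
      have hd : ∀ ζ ∈ closedBall (0 : ℂ) 1, DifferentiableAt ℂ (fun ζ : ℂ => u (a + ζ • w)) ζ := by
        intro ζ hζ
        have h := hu.differentiableAt (isOpen_holoCylinderAt.mem_nhds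
          (add_mem_holoCylinderAt_iff.2 (smul_mem_holoCylinder (by simpa using hζ) hw)))
        exact DifferentiableAt.comp ζ h (by fun_prop)
      rw [DiffContOnCl.circleAverage]
      · simp
      · rw [abs_one]
        refine DifferentiableOn.diffContOnCl fun ζ hζ => ?_
        rw [closure_ball _ one_ne_zero] at hζ
        exact (hd ζ hζ).differentiableWithinAt
    · rw [Set.indicator_of_notMem hw]
      rw [circleAverage_congr_sphere (f₂ := fun _ => (0 : ℂ))
        fun ζ hζ => Set.indicator_of_notMem (mt (hmem ζ hζ).1 hw) _, circleAverage_const]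
  rw [h1, ← integral_indicator hPm,
    integral_eq_integral_circleAverage ((integrable_indicator_iff hPm).2 hint')]
  simp only [h2]
  rw [integral_indicator hPm, setIntegral_const, measureReal_def, measureReal_def,
    volume_holoCylinderAt]

end MeanValue

/-! ### Minimal L² norms and extension index 1. -/

section Forward

variable {m : ℕ} {a : CSpace m} {r s : ℝ} {A : Matrix.unitaryGroup (Fin (m + 1)) ℂ}

open Set

theorem measurableSet_holoCylinderAt : MeasurableSet (holoCylinderAt a r s A) :=
  isOpen_holoCylinderAt.measurableSet

theorem volume_holoCylinderAt_ne_top : volume (holoCylinderAt a r s A) ≠ ∞ := by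
  rw [volume_holoCylinderAt]
  exact volume_holoCylinder_ne_top

theorem volume_real_holoCylinderAt_pos (hr : 0 < r) (hs : 0 < s) :
    0 < volume.real (holoCylinderAt a r s A) := by
  rw [measureReal_def, volume_holoCylinderAt]
  exact ENNReal.toReal_pos (volume_holoCylinder_pos hr hs).ne' volume_holoCylinder_ne_top

theorem ofReal_volume_real_holoCylinderAt :
    ENNReal.ofReal (volume.real (holoCylinderAt a r s A)) = volume (holoCylinder r s A) := by
  rw [measureReal_def, volume_holoCylinderAt, ENNReal.ofReal_toReal volume_holoCylinder_ne_top]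

theorem extensionBound_eq_ofReal (φ : CSpace m → ℝ) :
    extensionBound φ a r s A
      = ENNReal.ofReal (volume.real (holoCylinderAt a r s A) * Real.exp (-φ a)) := by
  rw [extensionBound, ENNReal.ofReal_mul measureReal_nonneg, ofReal_volume_real_holoCylinderAt]

theorem extensionBound_ne_zero (φ : CSpace m → ℝ) (hr : 0 < r) (hs : 0 < s) :
    extensionBound φ a r s A ≠ 0 := by
  rw [extensionBound_eq_ofReal]
  have := volume_real_holoCylinderAt_pos (a := a) (A := A) hr hs
  exact (ENNReal.ofReal_pos.2 (by positivity)).ne'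

theorem extensionBound_ne_top (φ : CSpace m → ℝ) : extensionBound φ a r s A ≠ ∞ := by
  rw [extensionBound_eq_ofReal]
  exact ENNReal.ofReal_ne_top

theorem integrableOn_of_lintegral_ofReal_ne_top {g : CSpace m → ℝ} {D : Set (CSpace m)}
    (hD : MeasurableSet D) (hg : ContinuousOn g D) (h0 : ∀ z, 0 ≤ g z)
    (h : ∫⁻ z in D, ENNReal.ofReal (g z) ≠ ∞) : IntegrableOn g D :=
  ⟨hg.aestronglyMeasurable hD,
    (hasFiniteIntegral_iff_ofReal (Filter.Eventually.of_forall h0)).2 h.lt_top⟩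

/-- Among holomorphic functions on a cylinder with value `1` at the centre, the constant function
is the only one of minimal `L²` norm. -/
theorem volume_le_lintegral_norm_sq {u : CSpace m → ℂ}
    (hu : DifferentiableOn ℂ u (holoCylinderAt a r s A)) (hua : u a = 1) :
    volume (holoCylinder r s A) ≤ ∫⁻ z in holoCylinderAt a r s A, ENNReal.ofReal (‖u z‖ ^ 2) ∧
    (∫⁻ z in holoCylinderAt a r s A, ENNReal.ofReal (‖u z‖ ^ 2) ≤ volume (holoCylinder r s A) →
      EqOn u 1 (holoCylinderAt a r s A)) := by
  set D := holoCylinderAt a r s A with hD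
  have hDm : MeasurableSet D := measurableSet_holoCylinderAt
  have hDt : volume D ≠ ∞ := volume_holoCylinderAt_ne_top
  by_cases htop : ∫⁻ z in D, ENNReal.ofReal (‖u z‖ ^ 2) = ∞
  · rw [htop]
    exact ⟨le_top, fun h => absurd (top_le_iff.1 h) volume_holoCylinder_ne_top⟩
  have hsq : IntegrableOn (fun z => ‖u z‖ ^ 2) D :=
    integrableOn_of_lintegral_ofReal_ne_top hDm (hu.continuousOn.norm.pow 2)
      (fun z => by positivity) htop
  have hone : IntegrableOn (fun _ : CSpace m => (1 : ℝ)) D := integrableOn_const hDt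
  have hui : IntegrableOn u D := by
    refine Integrable.mono' (hsq.add hone) (hu.continuousOn.aestronglyMeasurable hDm) ?_
    refine Filter.Eventually.of_forall fun z => ?_
    simp only [Pi.add_apply]
    nlinarith [sq_nonneg (‖u z‖ - 1), sq_nonneg (‖u z‖)]
  have hexp : ∀ z, ‖u z - 1‖ ^ 2 = ‖u z‖ ^ 2 - 2 * (u z).re + 1 := fun z => by
    rw [← Complex.normSq_eq_norm_sq, ← Complex.normSq_eq_norm_sq, Complex.normSq_sub]
    simp; ring
  have hmean : ∫ z in D, (u z).re = volume.real D := by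
    have h1 : ∫ z in D, (u z).re = (∫ z in D, u z).re := integral_re hui
    rw [h1, setIntegral_holoCylinderAt_eq hu hui, hua]
    simp [hD]
  -- Pythagoras: the mean value property makes u - 1 orthogonal to the constants.
  have hint : ∫ z in D, ‖u z - 1‖ ^ 2 = (∫ z in D, ‖u z‖ ^ 2) - volume.real D := by
    simp only [hexp]
    have hre : IntegrableOn (fun z => 2 * (u z).re) D := (hui.re).const_mul 2
    have hsub : IntegrableOn (fun z => ‖u z‖ ^ 2 - 2 * (u z).re) D := hsq.sub hre
    rw [integral_add hsub hone, integral_sub hsq hre, integral_const_mul, hmean,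
      setIntegral_const]
    simp; ring
  have hconv : ∫⁻ z in D, ENNReal.ofReal (‖u z‖ ^ 2) = ENNReal.ofReal (∫ z in D, ‖u z‖ ^ 2) :=
    (ofReal_integral_eq_lintegral_ofReal hsq
      (Filter.Eventually.of_forall fun z => by positivity)).symm
  rw [hconv, ← ofReal_volume_real_holoCylinderAt (a := a), ← hD]
  constructor
  · refine ENNReal.ofReal_le_ofReal ?_
    have : 0 ≤ ∫ z in D, ‖u z - 1‖ ^ 2 := integral_nonneg fun z => by positivity
    linarith
  · intro hle
    rw [ENNReal.ofReal_le_ofReal_iff measureReal_nonneg] at hle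
    have h0 : ∫ z in D, ‖u z - 1‖ ^ 2 = 0 :=
      le_antisymm (by linarith) (integral_nonneg fun z => by positivity)
    have hi : IntegrableOn (fun z => ‖u z - 1‖ ^ 2) D := by
      simp only [hexp]
      exact (hsq.sub ((hui.re).const_mul 2)).add hone
    have hae := (setIntegral_eq_zero_iff_of_nonneg_ae
      (Filter.Eventually.of_forall fun z => by positivity) hi).1 h0
    have heq := Measure.eqOn_open_of_ae_eq hae isOpen_holoCylinderAt
      ((hu.continuousOn.sub continuousOn_const).norm.pow 2) continuousOn_const
    intro z hz
    have : ‖u z - 1‖ ^ 2 = 0 := heq hz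
    simpa [sub_eq_zero] using this

/-- For a weight `φ = Re g` with `g` holomorphic, multiplication by `exp ((g a - g) / 2)` turns the
weighted `L²` norm into the unweighted one. -/
theorem weightedSqIntegral_eq_of_re_eq {φ : CSpace m → ℝ} {g : CSpace m → ℂ}
    {D : Set (CSpace m)} (hD : MeasurableSet D) (hgφ : ∀ z ∈ D, (g z).re = φ z) (ha : a ∈ D)
    (h : CSpace m → ℂ) :
    weightedSqIntegral φ D h = ENNReal.ofReal (Real.exp (-φ a))
      * ∫⁻ z in D, ENNReal.ofReal (‖h z * Complex.exp ((g a - g z) / 2)‖ ^ 2) := by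
  rw [weightedSqIntegral, ← lintegral_const_mul' _ _ ENNReal.ofReal_ne_top]
  refine setLIntegral_congr_fun hD fun z hz => ?_
  rw [← ENNReal.ofReal_mul (Real.exp_pos _).le]
  congr 1
  rw [norm_mul, Complex.norm_exp, mul_pow, ← Real.exp_nat_mul]
  have : ((g a - g z) / 2).re = (φ a - φ z) / 2 := by
    rw [← hgφ z hz, ← hgφ a ha]
    simp
  rw [this, mul_left_comm, ← Real.exp_add]
  push_cast
  ring_nf

/-- The exponential twist turns competitors for φ into competitors for the weight 0. The minimiser 1
there corresponds to exp((g - g(a))/2). -/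
theorem IsPluriharmonicOn.exists_optimal_extension {φ : CSpace m → ℝ} {Ω : Set (CSpace m)}
    (hΩ : IsOpen Ω) (hφ : IsPluriharmonicOn φ Ω) (hr : 0 < r) (hs : 0 < s)
    (hsub : holoCylinderAt a r s A ⊆ Ω) :
    (∀ h : CSpace m → ℂ, DifferentiableOn ℂ h (holoCylinderAt a r s A) → h a = 1 →
      extensionBound φ a r s A ≤ weightedSqIntegral φ (holoCylinderAt a r s A) h) ∧
    ∃ f : CSpace m → ℂ, IsOptimalExtension φ a r s A f ∧
      ∀ h : CSpace m → ℂ, IsOptimalExtension φ a r s A h →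
        EqOn h f (holoCylinderAt a r s A) := by
  set D := holoCylinderAt a r s A with hD
  have hDm : MeasurableSet D := measurableSet_holoCylinderAt
  have haD : a ∈ D := self_mem_holoCylinderAt hr hs
  obtain ⟨g, hg, hgφ⟩ := hφ.exists_differentiableOn_re_eq hΩ convex_holoCylinderAt
    isOpen_holoCylinderAt hsub
  have hw := fun h : CSpace m → ℂ => weightedSqIntegral_eq_of_re_eq hDm hgφ haD h
  have hE : ENNReal.ofReal (Real.exp (-φ a)) ≠ 0 := (ENNReal.ofReal_pos.2 (Real.exp_pos _)).ne'
  have hud : ∀ h : CSpace m → ℂ, DifferentiableOn ℂ h D →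
      DifferentiableOn ℂ (fun z => h z * Complex.exp ((g a - g z) / 2)) D := fun h hh => by
    fun_prop
  have hua : ∀ h : CSpace m → ℂ, h a = 1 → h a * Complex.exp ((g a - g a) / 2) = 1 :=
    fun h hh => by simp [hh]
  refine ⟨fun h hh hha => ?_, fun z => Complex.exp ((g z - g a) / 2), ⟨?_, ?_, ?_⟩,
    fun h ⟨hh, hha, hle⟩ z hz => ?_⟩
  · rw [hw, extensionBound, mul_comm]
    gcongr
    exact (volume_le_lintegral_norm_sq (hud h hh) (hua h hha)).1
  · exact DifferentiableOn.cexp (by fun_prop)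
  · simp
  · rw [hw, extensionBound, mul_comm]
    refine le_of_eq (congrArg (· * _) ?_)
    simp only [← Complex.exp_add, ← add_div, sub_add_sub_cancel, sub_self, zero_div,
      Complex.exp_zero, norm_one, one_pow, ENNReal.ofReal_one, setLIntegral_one]
    exact volume_holoCylinderAt
  · rw [hw, extensionBound, mul_comm, ENNReal.mul_le_mul_iff_left hE ENNReal.ofReal_ne_top] at hle
    have := (volume_le_lintegral_norm_sq (hud h hh) (hua h hha)).2 hle hz
    simp only [Pi.one_apply] at this
    rw [← mul_one (h z), ← Complex.exp_zero, show (0 : ℂ) = (g a - g z) / 2 + (g z - g a) / 2 by ring,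
      Complex.exp_add, ← mul_assoc, this, one_mul]

theorem extensionIndex_eq_one_of_isPluriharmonicOn {φ : CSpace m → ℝ} {Ω : Set (CSpace m)}
    (hΩ : IsOpen Ω) (hφ : IsPluriharmonicOn φ Ω) (hr : 0 < r) (hs : 0 < s)
    (hsub : holoCylinderAt a r s A ⊆ Ω) : extensionIndex φ a r s A = 1 := by
  obtain ⟨h1, f, ⟨hf, hfa, hfle⟩, -⟩ := hφ.exists_optimal_extension hΩ hr hs hsub
  have hb0 := extensionBound_ne_zero (a := a) (A := A) φ hr hs
  have hbt := extensionBound_ne_top (a := a) (r := r) (s := s) (A := A) φ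
  refine le_antisymm ?_ ?_
  · rw [extensionIndex]
    refine le_trans (sInf_le ⟨f, hf, hfle.trans_lt hbt.lt_top, hfa, rfl⟩) ?_
    exact ENNReal.div_le_of_le_mul (by rwa [one_mul])
  · refine le_sInf ?_
    rintro t ⟨h, hh, -, hha, rfl⟩
    rw [ENNReal.le_div_iff_mul_le (Or.inl hb0) (Or.inl hbt), one_mul]
    exact h1 h hh hha

/-- If the optimal extension exists and is unique, then the extension index equals `1`. -/
theorem extensionIndex_eq_one_of_existsUnique {φ : CSpace m → ℝ}
    (hr : 0 < r) (hs : 0 < s)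
    (h : ∃ f : CSpace m → ℂ, IsOptimalExtension φ a r s A f ∧
      ∀ g : CSpace m → ℂ, IsOptimalExtension φ a r s A g →
        EqOn g f (holoCylinderAt a r s A)) :
    extensionIndex φ a r s A = 1 := by
  obtain ⟨f, ⟨hf, hfa, hfle⟩, huniq⟩ := h
  set D := holoCylinderAt a r s A with hD
  have hDm : MeasurableSet D := measurableSet_holoCylinderAt
  have hb0 := extensionBound_ne_zero (a := a) (A := A) φ hr hs
  have hbt := extensionBound_ne_top (a := a) (r := r) (s := s) (A := A) φ
  refine le_antisymm ?_ ?_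
  · rw [extensionIndex]
    refine le_trans (sInf_le ⟨f, hf, hfle.trans_lt hbt.lt_top, hfa, rfl⟩) ?_
    exact ENNReal.div_le_of_le_mul (by rwa [one_mul])
  refine le_sInf ?_
  rintro t ⟨g, hg, -, hga, rfl⟩
  rw [ENNReal.le_div_iff_mul_le (Or.inl hb0) (Or.inl hbt), one_mul]
  -- Strict inequality leaves room to replace g by g(1 + εl), where l is the disc coordinate: l(a) =
  -- 0 and |l| ≤ C on D. Uniqueness then gives g·l = 0, which fails on the axis near a.
  by_contra! hlt
  obtain ⟨C, hC0, hC⟩ : ∃ C : ℝ, 0 < C ∧ ∀ z ∈ D, ‖(cylinderEquiv A).symm (z - a)‖ ≤ C := by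
    obtain ⟨C, hC0, hC⟩ := (((cylinderEquiv A).symm.lipschitz).isBounded_image
      (isBounded_holoCylinder (r := r) (s := s) (A := A))).exists_pos_norm_le
    refine ⟨C, hC0, fun z hz => hC _ ⟨z - a, ?_, rfl⟩⟩
    rw [← add_mem_holoCylinderAt_iff (a := a), add_sub_cancel]
    exact hz
  set l : CSpace m → ℂ := fun z => ((cylinderEquiv A).symm (z - a)).1 with hl
  have hlC : ∀ z ∈ D, ‖l z‖ ≤ C := fun z hz => (norm_fst_le _).trans (hC z hz)
  have hld : Differentiable ℂ l := by
    have : Differentiable ℂ fun z => (cylinderEquiv A).symm (z - a) :=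
      (cylinderEquiv A).symm.differentiable.comp (differentiable_id.sub_const a)
    exact this.fst
  have hla : l a = 0 := by simp [hl]
  have hpert : ∃ ε : ℝ, 0 < ε ∧ ENNReal.ofReal ((1 + ε * C) ^ 2) * weightedSqIntegral φ D g
      ≤ extensionBound φ a r s A := by
    have ht : Filter.Tendsto (fun ε : ℝ => ENNReal.ofReal ((1 + ε * C) ^ 2)
        * weightedSqIntegral φ D g) (nhdsWithin 0 (Ioi 0))
        (nhds (ENNReal.ofReal ((1 + 0 * C) ^ 2) * weightedSqIntegral φ D g)) := by
      refine ENNReal.Tendsto.mul_const ?_ (Or.inr hlt.ne_top)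
      have hc : Continuous fun ε : ℝ => ENNReal.ofReal ((1 + ε * C) ^ 2) :=
        ENNReal.continuous_ofReal.comp (by fun_prop)
      exact hc.continuousAt.tendsto.mono_left nhdsWithin_le_nhds
    have hev := ht.eventually_lt_const (u := extensionBound φ a r s A) (by simpa using hlt)
    obtain ⟨ε, hε, hε0⟩ := (hev.and self_mem_nhdsWithin).exists
    exact ⟨ε, hε0, hε.le⟩
  obtain ⟨ε, hε, hle⟩ := hpert
  have hg1 : IsOptimalExtension φ a r s A g := ⟨hg, hga, hlt.le⟩
  have hg2 : IsOptimalExtension φ a r s A (fun z => g z * (1 + ε * l z)) := by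
    refine ⟨by fun_prop, by simp [hga, hla], le_trans ?_ hle⟩
    rw [weightedSqIntegral, weightedSqIntegral, ← lintegral_const_mul' _ _ ENNReal.ofReal_ne_top]
    refine setLIntegral_mono' hDm fun z hz => ?_
    rw [← ENNReal.ofReal_mul (by positivity)]
    refine ENNReal.ofReal_le_ofReal ?_
    rw [norm_mul, mul_pow, mul_comm (‖g z‖ ^ 2), mul_assoc]
    gcongr
    refine (norm_add_le _ _).trans ?_
    rw [norm_one, norm_mul, Complex.norm_real, Real.norm_of_nonneg hε.le]
    gcongr
    exact hlC z hz
  have heq : ∀ z ∈ D, g z * l z = 0 := by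
    intro z hz
    have e1 := huniq _ hg1 hz
    have e2 := huniq _ hg2 hz
    have e3 : g z * (1 + ε * l z) = g z := by rw [e2, e1]
    have e4 : (ε : ℂ) * (g z * l z) = 0 := by linear_combination e3
    rcases mul_eq_zero.1 e4 with h | h
    · exact absurd (Complex.ofReal_eq_zero.1 h) hε.ne'
    · exact h
  have haD : a ∈ D := self_mem_holoCylinderAt hr hs
  have hgne : ∀ᶠ z in nhds a, g z ≠ 0 ∧ z ∈ D := by
    have hDn := isOpen_holoCylinderAt.mem_nhds haD
    have := (hg.continuousOn.continuousAt hDn).eventually_ne (y := 0) (by rw [hga]; exact one_ne_zero)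
    exact this.and hDn
  have hcont : Filter.Tendsto (fun t : ℝ => a + (t : ℂ) • cylinderEquiv A (1, 0))
      (nhdsWithin 0 (Ioi 0)) (nhds a) := by
    have : Continuous fun t : ℝ => a + (t : ℂ) • cylinderEquiv A (1, 0) := by fun_prop
    refine (this.tendsto' 0 a (by simp)).mono_left nhdsWithin_le_nhds
  obtain ⟨t, ⟨ht1, ht2⟩, ht0⟩ := ((hcont.eventually hgne).and self_mem_nhdsWithin).exists
  have := heq _ ht2
  have hlt : l (a + (t : ℂ) • cylinderEquiv A (1, 0)) = t := by
    simp only [hl, add_sub_cancel_left, map_smul, ContinuousLinearEquiv.symm_apply_apply]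
    simp
  rw [hlt] at this
  rcases mul_eq_zero.1 this with h | h
  · exact ht1 h
  · have ht0' : 0 < t := ht0
    exact absurd (Complex.ofReal_eq_zero.1 h) ht0'.ne'

end Forward

/-! ### Sub-mean value inequalities from the two bounds on the index. -/

section SubMean

variable {m : ℕ} {a : CSpace m} {r s : ℝ} {A : Matrix.unitaryGroup (Fin (m + 1)) ℂ}
  {φ : CSpace m → ℝ} {F : CSpace m → ℂ} {K : Set (CSpace m)}

open Set Metric

theorem ContinuousOn.integrableOn_holoCylinderAt {g : CSpace m → ℝ} (hg : ContinuousOn g K)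
    (hK : IsCompact K) (hsub : holoCylinderAt a r s A ⊆ K) :
    IntegrableOn g (holoCylinderAt a r s A) :=
  (hg.integrableOn_compact hK).mono_set hsub

/-- The competitor exp((F - F(a))/2) has squared modulus exp(Re F - Re F(a)); containment in a
compact set keeps its norm finite. -/
theorem sub_mean_exp_re_sub_of_one_le_extensionIndex (hr : 0 < r) (hs : 0 < s) (hK : IsCompact K)
    (hφ : ContinuousOn φ K) (hF : Differentiable ℂ F) (hsub : holoCylinderAt a r s A ⊆ K)
    (hidx : 1 ≤ extensionIndex φ a r s A) :
    volume.real (holoCylinderAt a r s A) * Real.exp ((F a).re - φ a)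
      ≤ ∫ z in holoCylinderAt a r s A, Real.exp ((F z).re - φ z) := by
  set D := holoCylinderAt a r s A with hD
  have hb0 := extensionBound_ne_zero (a := a) (A := A) φ hr hs
  have hbt := extensionBound_ne_top (a := a) (r := r) (s := s) (A := A) φ
  have hFre : Continuous fun z => (F z).re := Complex.continuous_re.comp hF.continuous
  have hint : IntegrableOn (fun z => Real.exp ((F z).re - φ z)) D :=
    ContinuousOn.integrableOn_holoCylinderAt
      (Real.continuous_exp.comp_continuousOn (hFre.continuousOn.sub hφ)) hK hsub
  have hw : weightedSqIntegral φ D (fun z => Complex.exp ((F z - F a) / 2))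
      = ENNReal.ofReal (Real.exp (-(F a).re) * ∫ z in D, Real.exp ((F z).re - φ z)) := by
    rw [ENNReal.ofReal_mul (Real.exp_pos _).le, ofReal_integral_eq_lintegral_ofReal hint
      (Filter.Eventually.of_forall fun z => (Real.exp_pos _).le),
      ← lintegral_const_mul' _ _ ENNReal.ofReal_ne_top, weightedSqIntegral]
    congr 1
    ext z
    rw [← ENNReal.ofReal_mul (Real.exp_pos _).le, Complex.norm_exp, ← Real.exp_nat_mul,
      ← Real.exp_add, ← Real.exp_add]
    congr 2
    simp
    ring
  have h1 : extensionIndex φ a r s A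
      ≤ weightedSqIntegral φ D (fun z => Complex.exp ((F z - F a) / 2)) / extensionBound φ a r s A := by
    refine sInf_le ⟨_, ?_, ?_, ?_, rfl⟩
    · exact (Differentiable.cexp (by fun_prop)).differentiableOn
    · rw [hw]; exact ENNReal.ofReal_lt_top
    · simp
  have h2 := hidx.trans h1
  have hint0 : 0 ≤ ∫ z in D, Real.exp ((F z).re - φ z) :=
    integral_nonneg fun z => (Real.exp_pos _).le
  rw [ENNReal.le_div_iff_mul_le (Or.inl hb0) (Or.inl hbt), one_mul, hw, extensionBound_eq_ofReal,
    ENNReal.ofReal_le_ofReal_iff (mul_nonneg (Real.exp_pos _).le hint0), ← hD] at h2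
  have h3 := mul_le_mul_of_nonneg_left h2 (Real.exp_pos (F a).re).le
  rw [← mul_assoc (Real.exp (F a).re) (Real.exp _), ← Real.exp_add, add_neg_cancel,
    Real.exp_zero, one_mul] at h3
  refine le_trans (le_of_eq ?_) h3
  rw [sub_eq_add_neg, Real.exp_add]
  ring

/-- For a nearly optimal f, the function u = f·exp(-(F - F(a))/2) has u(a) = 1, so the volume is at
most ∫|u|. Cauchy–Schwarz, in the form 2xy ≤ x² + y², bounds this by the weighted norm of f and the
integral on the right. -/
theorem sub_mean_exp_sub_re_of_extensionIndex_le_one (hr : 0 < r) (hs : 0 < s) (hK : IsCompact K)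
    (hφ : ContinuousOn φ K) (hF : Differentiable ℂ F) (hsub : holoCylinderAt a r s A ⊆ K)
    (hidx : extensionIndex φ a r s A ≤ 1) :
    volume.real (holoCylinderAt a r s A) * Real.exp (φ a - (F a).re)
      ≤ ∫ z in holoCylinderAt a r s A, Real.exp (φ z - (F z).re) := by
  set D := holoCylinderAt a r s A with hD
  have hDm : MeasurableSet D := measurableSet_holoCylinderAt
  have hb0 := extensionBound_ne_zero (a := a) (A := A) φ hr hs
  have hbt := extensionBound_ne_top (a := a) (r := r) (s := s) (A := A) φ
  have hFre : Continuous fun z => (F z).re := Complex.continuous_re.comp hF.continuous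
  have hV := volume_real_holoCylinderAt_pos (a := a) (A := A) hr hs
  rw [← hD] at hV
  set V := volume.real D with hVdef
  have hint : IntegrableOn (fun z => Real.exp (φ z - (F z).re)) D :=
    ContinuousOn.integrableOn_holoCylinderAt
      (Real.continuous_exp.comp_continuousOn (hφ.sub hFre.continuousOn)) hK hsub
  set J := ∫ z in D, Real.exp (φ z - (F z).re) with hJ
  set E := Real.exp (φ a - (F a).re) with hE
  have hE0 : 0 < E := Real.exp_pos _
  suffices hmain : ∀ ε : ℝ, 0 < ε → V ≤ (1 / 2) * ((1 + ε) * V + E⁻¹ * J) by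
    have h1 : V ≤ E⁻¹ * J := by
      refine le_of_forall_pos_le_add fun ε hε => ?_
      have := hmain (ε / V) (by positivity)
      have e : (1 + ε / V) * V = V + ε := by field_simp
      rw [e] at this
      linarith
    calc V * E ≤ (E⁻¹ * J) * E := mul_le_mul_of_nonneg_right h1 hE0.le
      _ = J := by field_simp
  intro ε hε
  obtain ⟨t, ⟨f, hf, hft, hfa, rfl⟩, hlt⟩ := sInf_lt_iff.1
    (show extensionIndex φ a r s A < ENNReal.ofReal (1 + ε) from hidx.trans_lt (by
      rw [ENNReal.one_lt_ofReal]; linarith))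
  have hφD : ContinuousOn φ D := hφ.mono hsub
  have hfc : ContinuousOn f D := hf.continuousOn
  have hwc : ContinuousOn (fun z => ‖f z‖ ^ 2 * Real.exp (-φ z)) D :=
    (hfc.norm.pow 2).mul (Real.continuous_exp.comp_continuousOn hφD.neg)
  have hwi : IntegrableOn (fun z => ‖f z‖ ^ 2 * Real.exp (-φ z)) D :=
    integrableOn_of_lintegral_ofReal_ne_top hDm hwc (fun z => by positivity) hft.ne
  have hwle : ∫ z in D, ‖f z‖ ^ 2 * Real.exp (-φ z) ≤ (1 + ε) * (V * Real.exp (-φ a)) := by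
    rw [ENNReal.div_lt_iff (Or.inl hb0) (Or.inl hbt), extensionBound_eq_ofReal,
      ← ENNReal.ofReal_mul (by positivity), weightedSqIntegral,
      ← ofReal_integral_eq_lintegral_ofReal hwi
        (Filter.Eventually.of_forall fun z => by positivity)] at hlt
    exact ((ENNReal.ofReal_lt_ofReal_iff (by positivity)).1 hlt).le
  set u : CSpace m → ℂ := fun z => f z * Complex.exp (-(F z - F a) / 2) with hu
  have hud : DifferentiableOn ℂ u D := by
    have : Differentiable ℂ fun z => Complex.exp (-(F z - F a) / 2) :=
      Differentiable.cexp (by fun_prop)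
    exact hf.mul this.differentiableOn
  have hua : u a = 1 := by simp [hu, hfa]
  have hun : ∀ z, ‖u z‖ ^ 2 = ‖f z‖ ^ 2 * Real.exp ((F a).re - (F z).re) := by
    intro z
    rw [hu]
    simp only
    rw [norm_mul, mul_pow, Complex.norm_exp, ← Real.exp_nat_mul]
    congr 2
    simp
    ring
  have hbound : ∀ z, ‖u z‖ ≤ (1 / 2) * (Real.exp (φ a) * (‖f z‖ ^ 2 * Real.exp (-φ z))
      + E⁻¹ * Real.exp (φ z - (F z).re)) := by
    intro z
    -- The factorisation |u| = (|u|x)·x⁻¹ is chosen so that the two squares are exactly the two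
    -- terms of the bound.
    set x := Real.exp (((φ a - (F a).re) - (φ z - (F z).re)) / 2) with hx
    have hx0 : 0 < x := Real.exp_pos _
    have hx2 : x ^ 2 = Real.exp ((φ a - (F a).re) - (φ z - (F z).re)) := by
      rw [hx, ← Real.exp_nat_mul]; congr 1; push_cast; ring
    have e1 : Real.exp (φ a) * (‖f z‖ ^ 2 * Real.exp (-φ z)) = (‖u z‖ * x) ^ 2 := by
      rw [mul_pow, hun, hx2, mul_assoc, ← Real.exp_add, mul_left_comm, ← Real.exp_add]
      ring_nf
    have e2 : E⁻¹ * Real.exp (φ z - (F z).re) = (x⁻¹) ^ 2 := by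
      rw [inv_pow, hx2, hE, ← Real.exp_neg, ← Real.exp_neg, ← Real.exp_add]
      ring_nf
    rw [e1, e2]
    have h3 := sq_nonneg (‖u z‖ * x - x⁻¹)
    have h4 : (‖u z‖ * x) * x⁻¹ = ‖u z‖ := by field_simp
    nlinarith
  have hi2 : IntegrableOn (fun z => (1 / 2) * (Real.exp (φ a) * (‖f z‖ ^ 2 * Real.exp (-φ z))
      + E⁻¹ * Real.exp (φ z - (F z).re))) D :=
    ((hwi.const_mul _).add (hint.const_mul _)).const_mul _
  have hui : IntegrableOn u D :=
    Integrable.mono' hi2 (hud.continuousOn.aestronglyMeasurable hDm)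
      (Filter.Eventually.of_forall hbound)
  have hmean := setIntegral_holoCylinderAt_eq hud hui
  rw [hua, ← hD, ← hVdef] at hmean
  calc V = ‖∫ z in D, u z‖ := by rw [hmean]; simp [abs_of_pos hV]
    _ ≤ ∫ z in D, ‖u z‖ := norm_integral_le_integral_norm _
    _ ≤ ∫ z in D, (1 / 2) * (Real.exp (φ a) * (‖f z‖ ^ 2 * Real.exp (-φ z))
      + E⁻¹ * Real.exp (φ z - (F z).re)) := integral_mono hui.norm hi2 hbound
    _ = (1 / 2) * (Real.exp (φ a) * (∫ z in D, ‖f z‖ ^ 2 * Real.exp (-φ z)) + E⁻¹ * J) := by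
      rw [integral_const_mul, integral_add (hwi.const_mul _) (hint.const_mul _),
        integral_const_mul, integral_const_mul]
    _ ≤ (1 / 2) * ((1 + ε) * V + E⁻¹ * J) := by
      have := mul_le_mul_of_nonneg_left hwle (Real.exp_pos (φ a)).le
      have e : Real.exp (φ a) * ((1 + ε) * (V * Real.exp (-φ a))) = (1 + ε) * V := by
        rw [Real.exp_neg]; field_simp
      rw [e] at this
      gcongr

end SubMean

/-! ### Harmonicity on complex lines. -/

section Disc

variable {m : ℕ} {Ω : Set (CSpace m)}

open Metric

theorem integral_ball_eq_scale {N : ℝ} (hN : 0 < N) (r : ℝ) (z₀ : ℂ) (v : ℂ → ℝ) :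
    ∫ ζ in ball z₀ r, v ζ
      = (N ^ 2)⁻¹ * ∫ ζ in ball (0 : ℂ) (N * r), v (z₀ + (N⁻¹ : ℂ) * ζ) := by
  have hpre : (fun w => z₀ + w) ⁻¹' ball z₀ r = ball 0 r := by
    ext w; simp [mem_ball, dist_eq_norm]
  rw [← (measurePreserving_add_left (volume : Measure ℂ) z₀).setIntegral_preimage_emb
    (measurableEmbedding_addLeft z₀) v, hpre]
  have h := Measure.setIntegral_comp_smul_of_pos (volume : Measure ℂ)
    (fun ζ => v (z₀ + (N⁻¹ : ℂ) * ζ)) (ball 0 r) hN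
  rw [Complex.finrank_real_complex, _root_.smul_ball hN.ne', smul_zero, Real.norm_of_nonneg hN.le,
    smul_eq_mul] at h
  rw [← h]
  have hN' : (N : ℂ) ≠ 0 := Complex.ofReal_ne_zero.2 hN.ne'
  simp [hN']

/-- The sub-mean value inequality on all cylinders inside compact subsets of `Ω` gives the area
sub-mean value inequality on discs in complex lines. -/
theorem sub_mean_line_of_sub_mean_holoCylinderAt (hΩ : IsOpen Ω) {g : CSpace m → ℝ}
    (hg : ContinuousOn g Ω) {a b : CSpace m} (hb : b ≠ 0)
    (h : ∀ (K : Set (CSpace m)) (c : CSpace m) (r s : ℝ) (A : Matrix.unitaryGroup (Fin (m + 1)) ℂ),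
      IsCompact K → K ⊆ Ω → 0 < r → 0 < s → holoCylinderAt c r s A ⊆ K →
      volume.real (holoCylinderAt c r s A) * g c ≤ ∫ z in holoCylinderAt c r s A, g z)
    {z₀ : ℂ} {r : ℝ} (hr : 0 < r) (hsub : ∀ ζ ∈ closedBall z₀ r, a + ζ • b ∈ Ω) :
    volume.real (ball z₀ r) * g (a + z₀ • b) ≤ ∫ ζ in ball z₀ r, g (a + ζ • b) := by
  set N := ‖b‖ with hN
  have hN0 : 0 < N := norm_pos_iff.2 hb
  have hNC : (N : ℂ) ≠ 0 := Complex.ofReal_ne_zero.2 hN0.ne'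
  -- Cylinder axes are unit vectors, so the disc of radius r in ζ becomes one of radius ‖b‖r.
  obtain ⟨A, hA⟩ := exists_cylinderEquiv_apply_eq (b := (N⁻¹ : ℂ) • b) (by
    rw [norm_smul, norm_inv, Complex.norm_real, Real.norm_of_nonneg hN0.le, ← hN,
      inv_mul_cancel₀ hN0.ne'])
  have hC : IsCompact ((fun ζ : ℂ => a + ζ • b) '' closedBall z₀ r) :=
    (isCompact_closedBall z₀ r).image (by fun_prop)
  obtain ⟨K, hK, hCK, hKΩ⟩ := exists_compact_between hC hΩ (by
    rintro _ ⟨ζ, hζ, rfl⟩; exact hsub ζ hζ)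
  have hpt : ∀ ζ : ℂ, a + z₀ • b + ζ • cylinderEquiv A (1, 0)
      = a + (z₀ + (N⁻¹ : ℂ) * ζ) • b := fun ζ => by
    rw [hA, smul_smul, add_smul, mul_comm, add_assoc]
  have hdisc := sub_mean_disc_of_sub_mean_holoCylinderAt (a := a + z₀ • b) (A := A) (g := g)
    (r := N * r) (Ω := interior K) isOpen_interior (hg.mono (interior_subset.trans hKΩ))
    (by positivity) (by
      intro ζ hζ
      rw [hpt]
      refine hCK ⟨_, ?_, rfl⟩
      rw [mem_closedBall, dist_eq_norm, add_sub_cancel_left, norm_mul, norm_inv, Complex.norm_real,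
        Real.norm_of_nonneg hN0.le, inv_mul_le_iff₀ hN0]
      simpa using hζ)
    (fun s hs hsubK => h K _ _ s A hK hKΩ (by positivity) hs (hsubK.trans interior_subset))
  simp only [hpt] at hdisc
  have h1 := integral_ball_eq_scale hN0 r z₀ (fun _ => 1)
  rw [setIntegral_const, setIntegral_const, smul_eq_mul, mul_one, smul_eq_mul, mul_one] at h1
  rw [h1, integral_ball_eq_scale hN0, mul_assoc]
  gcongr

open InnerProductSpace in
/-- If the extension index is identically `1`, the restriction of `φ` to complex lines is
harmonic. -/
theorem harmonicOnNhd_line_of_extensionIndex_eq_one (hΩ : IsOpen Ω) {φ : CSpace m → ℝ}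
    (hφ : ContinuousOn φ Ω)
    (h : ∀ (a : CSpace m) (r s : ℝ) (A : Matrix.unitaryGroup (Fin (m + 1)) ℂ),
        0 < r → 0 < s → holoCylinderAt a r s A ⊆ Ω → extensionIndex φ a r s A = 1)
    {a b : CSpace m} (hsub : ∀ ζ ∈ closedBall (0 : ℂ) 1, a + ζ • b ∈ Ω) :
    HarmonicOnNhd (fun ζ : ℂ => φ (a + ζ • b)) (ball 0 1) := by
  rcases eq_or_ne b 0 with rfl | hb
  · simp
  have hline : Continuous fun ζ : ℂ => a + ζ • b := by fun_prop
  have hcont : ContinuousOn (fun ζ : ℂ => φ (a + ζ • b)) (closedBall 0 1) :=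
    hφ.comp hline.continuousOn hsub
  refine harmonicOnNhd_ball_of_approx hcont fun P hP δ hδ => ?_
  -- Orthogonal projection onto the line extends P to an entire function on the whole space.
  set F : CSpace m → ℂ := fun z => P (inner ℂ b (z - a) / (‖b‖ ^ 2 : ℝ)) with hF
  have hb2 : ((‖b‖ ^ 2 : ℝ) : ℂ) ≠ 0 :=
    Complex.ofReal_ne_zero.2 (pow_ne_zero 2 (norm_ne_zero_iff.2 hb))
  have hFline : ∀ ζ : ℂ, F (a + ζ • b) = P ζ := fun ζ => by
    simp only [hF, add_sub_cancel_left, inner_smul_right, inner_self_eq_norm_sq_to_K]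
    congr 1
    rw [div_eq_iff hb2]
    simp
  have hFd : Differentiable ℂ F := by
    have : Differentiable ℂ fun z => inner ℂ b (z - a) :=
      (innerSL ℂ b).differentiable.comp (differentiable_id.sub_const a)
    have h' : Differentiable ℂ fun z => inner ℂ b (z - a) / ((‖b‖ ^ 2 : ℝ) : ℂ) := by
      simp only [div_eq_mul_inv]
      exact this.mul_const _
    exact hP.comp h'
  have hFre : Continuous fun z => (F z).re := Complex.continuous_re.comp hFd.continuous
  -- The maximum principle is applied to exp(g), and monotonicity of exp returns to g. It is used
  -- for both signs of φ - Re F.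
  have key : ∀ g : CSpace m → ℝ, ContinuousOn g Ω →
      (∀ (K : Set (CSpace m)) (c : CSpace m) (r s : ℝ) (A : Matrix.unitaryGroup (Fin (m + 1)) ℂ),
        IsCompact K → K ⊆ Ω → 0 < r → 0 < s → holoCylinderAt c r s A ⊆ K →
        volume.real (holoCylinderAt c r s A) * Real.exp (g c)
          ≤ ∫ z in holoCylinderAt c r s A, Real.exp (g z)) →
      (∀ z ∈ sphere (0 : ℂ) 1, g (a + z • b) ≤ δ) → ∀ z ∈ ball (0 : ℂ) 1, g (a + z • b) ≤ δ := by
    intro g hg hsm hgs z hz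
    have hgl : ContinuousOn (fun ζ : ℂ => g (a + ζ • b)) (closedBall 0 1) :=
      hg.comp hline.continuousOn hsub
    have := le_of_sub_mean_of_le_sphere (v := fun ζ => Real.exp (g (a + ζ • b))) (M := Real.exp δ)
      (Real.continuous_exp.comp_continuousOn hgl) (fun z hz => Real.exp_le_exp.2 (hgs z hz))
      (fun z r hr hzr => sub_mean_line_of_sub_mean_holoCylinderAt hΩ
        (Real.continuous_exp.comp_continuousOn hg) hb hsm hr
        fun ζ hζ => hsub ζ (ball_subset_closedBall (hzr hζ))) z (ball_subset_closedBall hz)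
    exact Real.exp_le_exp.1 this
  intro z hz
  rw [abs_le']
  constructor
  · have := key (fun z => φ z - (F z).re) (hφ.sub hFre.continuousOn)
      (fun K c r s A hK hKΩ hr hs hsubK => sub_mean_exp_sub_re_of_extensionIndex_le_one hr hs hK
        (hφ.mono hKΩ) hFd hsubK (h c r s A hr hs (hsubK.trans hKΩ)).le)
      (fun z hz => by rw [hFline]; exact (abs_le'.1 (hδ z hz)).1) z hz
    rwa [hFline] at this
  · have := key (fun z => (F z).re - φ z) (hFre.continuousOn.sub hφ)
      (fun K c r s A hK hKΩ hr hs hsubK => sub_mean_exp_re_sub_of_one_le_extensionIndex hr hs hK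
        (hφ.mono hKΩ) hFd hsubK (h c r s A hr hs (hsubK.trans hKΩ)).ge)
      (fun z hz => by rw [hFline]; linarith [(abs_le'.1 (hδ z hz)).2]) z hz
    rw [hFline] at this
    linarith

end Disc

/-! ### Regularity by radial mollification. -/

section Smoothness

variable {m : ℕ} {Ω : Set (CSpace m)} {φ : CSpace m → ℝ}

open Metric Real InnerProductSpace

/-- A continuous function whose restriction to every disc in a complex line is harmonic is smooth:
it coincides locally with its convolution against a radial mollifier. -/
theorem contDiffAt_of_harmonicOnNhd_line (hΩ : IsOpen Ω) (hφ : ContinuousOn φ Ω)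
    (h : ∀ a b : CSpace m, (∀ ζ ∈ closedBall (0 : ℂ) 1, a + ζ • b ∈ Ω) →
      HarmonicOnNhd (fun ζ : ℂ => φ (a + ζ • b)) (ball 0 1))
    {a : CSpace m} (ha : a ∈ Ω) : ContDiffAt ℝ 2 φ a := by
  obtain ⟨R', hR', hRΩ'⟩ := nhds_basis_closedBall.mem_iff.1 (hΩ.mem_nhds ha)
  set R := R' / 4 with hRdef
  have hR : 0 < R := by positivity
  have hRΩ : closedBall a (4 * R) ⊆ Ω := by
    rwa [hRdef, mul_div_cancel₀ _ (by norm_num : (4 : ℝ) ≠ 0)]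
  -- Using the direction -2t puts the relevant circle at |ζ| = 1/2, inside the open disc of
  -- harmonicity. The closed disc stays within 3R of a.
  have hmean : ∀ x ∈ ball a R, ∀ t : CSpace m, ‖t‖ ≤ R →
      circleAverage (fun ζ : ℂ => φ (x - ζ • t)) 0 1 = φ x := by
    intro x hx t ht
    have hh := h x ((-2 : ℂ) • t) fun ζ hζ => hRΩ (by
      rw [mem_closedBall, dist_eq_norm]
      rw [mem_ball, dist_eq_norm] at hx
      rw [mem_closedBall, dist_zero_right] at hζ
      have h1 : ‖ζ • (-2 : ℂ) • t‖ ≤ 2 * R := by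
        rw [norm_smul, norm_smul, norm_neg, Complex.norm_ofNat]
        nlinarith [norm_nonneg t, norm_nonneg ζ]
      calc ‖x + ζ • (-2 : ℂ) • t - a‖ = ‖(x - a) + ζ • (-2 : ℂ) • t‖ := by congr 1; abel
        _ ≤ ‖x - a‖ + ‖ζ • (-2 : ℂ) • t‖ := norm_add_le _ _
        _ ≤ 4 * R := by linarith)
    have hc := (hh.mono (t := closedBall (0 : ℂ) |1 / 2|) (closedBall_subset_ball (by
      rw [abs_of_pos] <;> norm_num))).circleAverage_eq
    rw [circleAverage_eq_circleAverage_zero_one, zero_smul, add_zero] at hc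
    rw [← hc]
    congr 1
    ext ζ
    rw [smul_smul, sub_eq_add_neg, ← neg_smul]
    congr 3
    push_cast
    ring
  set ρ : CSpace m → ℝ := fun w => smoothTransition (1 - ‖w‖ ^ 2 / R ^ 2) with hρ
  have hρs : ContDiff ℝ 2 ρ :=
    smoothTransition.contDiff.comp (contDiff_const.sub ((contDiff_norm_sq ℝ).div_const _))
  have hρ0 : ∀ w, R ≤ ‖w‖ → ρ w = 0 := fun w hw => by
    refine smoothTransition.zero_of_nonpos ?_
    rw [sub_nonpos, one_le_div (by positivity)]
    gcongr
  have hρc : HasCompactSupport ρ := by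
    refine HasCompactSupport.intro (isCompact_closedBall (0 : CSpace m) R) fun w hw => hρ0 w ?_
    rw [mem_closedBall, dist_zero_right, not_le] at hw
    exact hw.le
  have hρint : 0 < ∫ w, ρ w := by
    refine hρs.continuous.integral_pos_of_hasCompactSupport_nonneg_nonzero hρc
      (fun w => smoothTransition.nonneg _) (x := 0) ?_
    simp [hρ]
  set φ' : CSpace m → ℝ := (closedBall a (4 * R)).indicator φ with hφ'
  have hφ'i : Integrable φ' :=
    ((hφ.mono hRΩ).integrableOn_compact (isCompact_closedBall _ _)).integrable_indicator
      measurableSet_closedBall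
  set L := ContinuousLinearMap.lsmul ℝ ℝ (E := ℝ)
  have hconv : ContDiff ℝ 2 (convolution ρ φ' L volume) :=
    hρc.contDiff_convolution_left L (n := 2) hρs hφ'i.locallyIntegrable
  have hex := hρc.convolutionExists_left L hρs.continuous hφ'i.locallyIntegrable (μ := volume)
  -- On each circle orbit ρ is constant and φ averages to φ(x). Only ‖t‖ < R contributes, so cutting
  -- φ off outside the ball does not matter.
  have heq : ∀ x ∈ ball a R, convolution ρ φ' L volume x = (∫ w, ρ w) * φ x := by
    intro x hx
    have hG : Integrable (fun t => ρ t * φ' (x - t)) := hex x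
    change ∫ t, ρ t * φ' (x - t) = _
    rw [integral_eq_integral_circleAverage hG, ← integral_mul_const]
    congr 1
    ext t
    have hρt : ∀ ζ ∈ sphere (0 : ℂ) |1|, ρ (ζ • t) = ρ t := fun ζ hζ => by
      have hζ1 : ‖ζ‖ = 1 := by simpa using hζ
      simp only [hρ, norm_smul, hζ1, one_mul]
    rcases le_or_gt R ‖t‖ with ht | ht
    · rw [circleAverage_congr_sphere (f₂ := fun _ => (0 : ℝ)) fun ζ hζ => by
        simp only [hρt ζ hζ, hρ0 t ht, zero_mul], circleAverage_const, hρ0 t ht, zero_mul]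
    · rw [circleAverage_congr_sphere (f₂ := fun ζ : ℂ => ρ t • φ (x - ζ • t)) fun ζ hζ => by
        have hζ1 : ‖ζ‖ = 1 := by simpa using hζ
        have hmem : x - ζ • t ∈ closedBall a (4 * R) := by
          rw [mem_ball, dist_eq_norm] at hx
          rw [mem_closedBall, dist_eq_norm, sub_right_comm]
          refine (norm_sub_le _ _).trans ?_
          rw [norm_smul, hζ1, one_mul]
          linarith
        simp only [hρt ζ hζ, hφ', Set.indicator_of_mem hmem, smul_eq_mul]]
      have := circleAverage_fun_smul (a := ρ t) (f := fun ζ : ℂ => φ (x - ζ • t)) (c := 0) (R := 1)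
      rw [this, hmean x hx t ht.le, smul_eq_mul]
  have hloc : φ =ᶠ[nhds a] fun x => (∫ w, ρ w)⁻¹ * convolution ρ φ' L volume x := by
    filter_upwards [ball_mem_nhds a hR] with x hx
    rw [heq x hx, inv_mul_cancel_left₀ hρint.ne']
  exact ((contDiff_const.mul hconv).contDiffAt).congr_of_eventuallyEq hloc

/-- Harmonicity is local, so a small disc about ζ₀ is rescaled to the unit disc. It is carried back
by composing a holomorphic function, whose real part is the restriction, with the affine map. -/
theorem isPluriharmonicOn_of_harmonicOnNhd_line (hΩ : IsOpen Ω) (hφ : ContinuousOn φ Ω)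
    (h : ∀ a b : CSpace m, (∀ ζ ∈ closedBall (0 : ℂ) 1, a + ζ • b ∈ Ω) →
      HarmonicOnNhd (fun ζ : ℂ => φ (a + ζ • b)) (ball 0 1)) : IsPluriharmonicOn φ Ω := by
  refine ⟨fun a ha => (contDiffAt_of_harmonicOnNhd_line hΩ hφ h ha).contDiffWithinAt,
    fun a b ζ₀ hζ₀ => ?_⟩
  have hc : Continuous fun η : ℂ => a + (ζ₀ + η) • b := by fun_prop
  obtain ⟨R, hR, hRΩ⟩ := nhds_basis_closedBall.mem_iff.1
    ((hΩ.preimage hc).mem_nhds (x := 0) (by simpa using hζ₀))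
  have hRC : (R : ℂ) ≠ 0 := Complex.ofReal_ne_zero.2 hR.ne'
  have hh := h (a + ζ₀ • b) ((R : ℂ) • b) fun ζ hζ => by
    have : (R : ℂ) * ζ ∈ closedBall (0 : ℂ) R := by
      rw [mem_closedBall, dist_zero_right] at hζ ⊢
      rw [norm_mul, Complex.norm_real, norm_of_nonneg hR.le]
      nlinarith
    have := hRΩ this
    rw [Set.mem_preimage, add_smul, ← add_assoc, mul_comm, mul_smul] at this
    exact this
  obtain ⟨F, hF, hFeq⟩ := hh.exists_analyticOnNhd_ball_re_eq
  have hcomp : AnalyticAt ℂ (fun ζ => F ((ζ - ζ₀) / R)) ζ₀ := by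
    refine AnalyticAt.fun_comp (g := F) (f := fun ζ => (ζ - ζ₀) / R) ?_ ?_
    · exact hF _ (by simp)
    · exact (analyticAt_id.sub analyticAt_const).div_const
  refine (harmonicAt_congr_nhds ?_).1 hcomp.harmonicAt_re
  have hcont : Continuous fun ζ : ℂ => (ζ - ζ₀) / (R : ℂ) := by fun_prop
  have hev : ∀ᶠ ζ in nhds ζ₀, (ζ - ζ₀) / (R : ℂ) ∈ ball (0 : ℂ) 1 :=
    hcont.continuousAt.eventually_mem (isOpen_ball.mem_nhds (by simp))
  filter_upwards [hev] with ζ hζ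
  have := hFeq hζ
  simp only at this
  rw [this, smul_smul, div_mul_cancel₀ _ hRC, add_assoc, ← add_smul, add_sub_cancel]

theorem isPluriharmonicOn_of_extensionIndex_eq_one (hΩ : IsOpen Ω) (hφ : ContinuousOn φ Ω)
    (h : ∀ (a : CSpace m) (r s : ℝ) (A : Matrix.unitaryGroup (Fin (m + 1)) ℂ),
        0 < r → 0 < s → holoCylinderAt a r s A ⊆ Ω → extensionIndex φ a r s A = 1) :
    IsPluriharmonicOn φ Ω :=
  isPluriharmonicOn_of_harmonicOnNhd_line hΩ hφ fun _ _ hsub =>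
    harmonicOnNhd_line_of_extensionIndex_eq_one hΩ hφ h hsub

end Smoothness

/-! ### The three characterisations. -/

/-- Functions on a cylinder are represented by functions on the whole space, of which only the
values on the cylinder matter; uniqueness is therefore equality on the cylinder. -/
theorem theorem1p2 (m : ℕ) (Ω : Set (CSpace m)) (hΩ : IsOpen Ω) (hΩc : IsConnected Ω)
    (φ : CSpace m → ℝ) (hφ : ContinuousOn φ Ω) :
    (IsPluriharmonicOn φ Ω ↔
      ∀ (a : CSpace m) (r s : ℝ) (A : Matrix.unitaryGroup (Fin (m + 1)) ℂ),
        0 < r → 0 < s → holoCylinderAt a r s A ⊆ Ω →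
          ∃ f : CSpace m → ℂ, IsOptimalExtension φ a r s A f ∧
            ∀ g : CSpace m → ℂ, IsOptimalExtension φ a r s A g →
              Set.EqOn g f (holoCylinderAt a r s A)) ∧
    (IsPluriharmonicOn φ Ω →
      ∀ (a : CSpace m) (r s : ℝ) (A : Matrix.unitaryGroup (Fin (m + 1)) ℂ),
        0 < r → 0 < s → holoCylinderAt a r s A ⊆ Ω →
          ∀ f : CSpace m → ℂ, IsOptimalExtension φ a r s A f →
            weightedSqIntegral φ (holoCylinderAt a r s A) f = extensionBound φ a r s A) ∧
    (IsPluriharmonicOn φ Ω ↔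
      ∀ (a : CSpace m) (r s : ℝ) (A : Matrix.unitaryGroup (Fin (m + 1)) ℂ),
        0 < r → 0 < s → holoCylinderAt a r s A ⊆ Ω → extensionIndex φ a r s A = 1) := by
  refine ⟨⟨fun h a r s A hr hs hsub => (h.exists_optimal_extension hΩ hr hs hsub).2,
    fun h => isPluriharmonicOn_of_extensionIndex_eq_one hΩ hφ fun a r s A hr hs hsub =>
      extensionIndex_eq_one_of_existsUnique hr hs (h a r s A hr hs hsub)⟩,
    fun h a r s A hr hs hsub f hf =>
      le_antisymm hf.2.2 ((h.exists_optimal_extension hΩ hr hs hsub).1 f hf.1 hf.2.1),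
    ⟨fun h a r s A hr hs hsub => extensionIndex_eq_one_of_isPluriharmonicOn hΩ h hr hs hsub,
      isPluriharmonicOn_of_extensionIndex_eq_one hΩ hφ⟩⟩
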